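/- **Conventions.** Let $L_0$ be a language with one binary relation symbol $E$. Consider three classes of finite $L_0$-structures (the empty structure is allowed): $\mathbf{LO}$, the finite strict linear orders; $\mathbf{T}$, the finite tournaments ($E$ is irreflexive and, for all distinct $a,b$, exactly one of $E(a,b)$, $E(b,a)$ holds); and $\mathbf{G}$, the finite graphs ($E$ is irreflexive and symmetric). For classes $\mathbf{K}_0,\mathbf{K}_1$ of finite structures in relational languages $L_0, L_1$, the free superposition $\mathbf{K}_0 * \mathbf{K}_1$ is the class of all finite structures in the disjoint union of $L_0$ and $L_1$ whose reduct to $L_t$ lies in $\mathbf{K}_t$ for $t=0,1$. Put $\mathbf{K}^{*1}=\mathbf{K}$ and $\mathbf{K}^{*(m+1)}=\mathbf{K}^{*m}*\mathbf{K}$ for $m \ge 1$. Let $T$ be the theory of the random graph, in the language $L$ with one binary relation symbol: $T$ is axiomatized by the axioms of graphs together with, for all $k,l<\omega$, the axiom saying that for all $x_0,\dots,x_{k-1},y_0,\dots,y_{l-1}$ with $x_i\ne y_j$ for all $i,j$, there is $z$ adjacent to every $x_i$, and different from and not adjacent to every $y_j$. Let $\mathfrak{C}$ be any $\aleph_1$-saturated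 model of $T$. Let $n \ge 1$. For a Fraïssé class $\mathbf{K}$ in a finite relational language, with Fraïssé limit $\Gamma$, a $\mathbf{K}$-configuration into $\mathfrak{C}^n$ is a function $f:\Gamma\to\mathfrak{C}^n$ such that for every relation symbol $R$ of the language of $\mathbf{K}$, of arity $k$, there is an $L$-formula $\varphi_R(\overline y_0,\dots,\overline y_{k-1})$ with parameters from $\mathfrak{C}$ such that for all $a_0,\dots,a_{k-1}\in\Gamma$, $$\Gamma\models R(a_0,\dots,a_{k-1}) \iff \mathfrak{C}\models\varphi_R(f(a_0),\dots,f(a_{k-1})).$$ For $\mathbf{K}\in\{\mathbf{LO},\mathbf{T},\mathbf{G}\}$, the rank $\mathrm{Rk}_{\mathbf{K}}(n)$ is defined to be $0$ if there is no $\mathbf{K}$-configuration into $\mathfrak{C}^n$; $m\ge 1$ if there is a $\mathbf{K}^{*m}$-configuration into $\mathfrak{C}^n$ but no $\mathbf{K}^{*(m+1)}$-configuration into $\mathfrak{C}^n$; and $\infty$ if there is a $\mathbf{K}^{*m}$-configuration into $\mathfrak{C}^n$ for every $m \ge 1$. **Theorem.** For every $n\ge 1$, the ranks $\mathrm{Rk}_{\mathbf{LO}}(n)$,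 $\mathrm{Rk}_{\mathbf{T}}(n)$ and $\mathrm{Rk}_{\mathbf{G}}(n)$ are well defined (exactly one value in $\{0,1,2,\dots,\infty\}$ satisfies the definition), and $$\mathrm{Rk}_{\mathbf{LO}}(n)=n^2-1,\qquad \mathrm{Rk}_{\mathbf{T}}(n)=n^2-1,\qquad \mathrm{Rk}_{\mathbf{G}}(n)=\begin{cases}1 & \text{if } n=1,\\ n^2-1 & \text{if } n\ge 2.\end{cases}$$ -/

import Mathlib

namespace KRank

open FirstOrder FirstOrder.Language FirstOrder.Language.Structure CategoryTheory

/-! ### Index side: classes of finite relational structures -/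

/-- The relation symbol `R` is symmetric on `A`. -/
def RelSymmetric {L₀ : FirstOrder.Language.{0, 0}} {n : ℕ} (R : L₀.Relations n) (A : Type)
    [L₀.Structure A] : Prop :=
  ∀ (a : Fin n → A) (σ : Equiv.Perm (Fin n)), RelMap R a → RelMap R (a ∘ σ)

/-- The relation symbol `R` is trichotomous on `A`. -/
def RelTrichotomous {L₀ : FirstOrder.Language.{0, 0}} {n : ℕ} (R : L₀.Relations n) (A : Type)
    [L₀.Structure A] : Prop :=
  ∀ a : Fin n → A, (∀ i j, i < j → a i ≠ a j) →
    ∃! σ : Equiv.Perm (Fin n), RelMap R (a ∘ σ)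

/-- The relation symbol `R` is irreflexive on `A`. -/
def RelIrreflexive {L₀ : FirstOrder.Language.{0, 0}} {n : ℕ} (R : L₀.Relations n) (A : Type)
    [L₀.Structure A] : Prop :=
  ∀ a : Fin n → A, (∃ i j, i < j ∧ a i = a j) → ¬ RelMap R a

/-- The binary relation symbol `R` is transitive on `A`. -/
def RelTransitive {L₀ : FirstOrder.Language.{0, 0}} (R : L₀.Relations 2) (A : Type)
    [L₀.Structure A] : Prop :=
  ∀ a b c : A, RelMap R ![a, b] → RelMap R ![b, c] → RelMap R ![a, c]

/-- The relation symbols of a language with a single, binary relation symbol. -/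
inductive BinRel : ℕ → Type
  | E : BinRel 2

/-- The language with one binary relation symbol `E` (and nothing else). -/
def binLang : FirstOrder.Language.{0, 0} := ⟨fun _ => Empty, BinRel⟩

instance : binLang.IsRelational := fun _ => inferInstanceAs (IsEmpty Empty)

/-- The relation symbol of `binLang`. -/
def symbE : binLang.Relations 2 := BinRel.E

/-- The class of finite (strict) linear orders. -/
def LO : Set (Bundled.{0} binLang.Structure) :=
  {A | Finite A ∧ RelTrichotomous symbE A ∧ RelIrreflexive symbE A ∧ RelTransitive symbE A}

/-- The class of finite tournaments. -/
def Tour : Set (Bundled.{0} binLang.Structure) :=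
  {A | Finite A ∧ RelTrichotomous symbE A ∧ RelIrreflexive symbE A}

/-- The class of finite graphs. -/
def Gr : Set (Bundled.{0} binLang.Structure) :=
  {A | Finite A ∧ RelSymmetric symbE A ∧ RelIrreflexive symbE A}

/-- The free superposition `K₀ * K₁`: the finite structures in the disjoint union of the two
languages whose reduct to each of the two languages lies in the corresponding class. -/
def freeSuperposition {L₀ L₁ : FirstOrder.Language.{0, 0}} (K₀ : Set (Bundled.{0} L₀.Structure))
    (K₁ : Set (Bundled.{0} L₁.Structure)) : Set (Bundled.{0} (L₀.sum L₁).Structure) :=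
  {A | Finite A ∧
    (⟨A, (LHom.sumInl : L₀ →ᴸ L₀.sum L₁).reduct A⟩ : Bundled.{0} L₀.Structure) ∈ K₀ ∧
    (⟨A, (LHom.sumInr : L₁ →ᴸ L₀.sum L₁).reduct A⟩ : Bundled.{0} L₁.Structure) ∈ K₁}

/-- The language of `K^{*n}`: a disjoint union of `n` copies of `L₀`. -/
def starLang (L₀ : FirstOrder.Language.{0, 0}) : ℕ → FirstOrder.Language.{0, 0}
  | 0 => Language.empty
  | 1 => L₀
  | n + 2 => (starLang L₀ (n + 1)).sum L₀

instance starLang.isRelational (L₀ : FirstOrder.Language.{0, 0}) [L₀.IsRelational] :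
    (n : ℕ) → (starLang L₀ n).IsRelational
  | 0 => inferInstanceAs Language.empty.IsRelational
  | 1 => inferInstanceAs L₀.IsRelational
  | n + 2 =>
    haveI := starLang.isRelational L₀ (n + 1)
    inferInstanceAs ((starLang L₀ (n + 1)).sum L₀).IsRelational

/-- The iterated free superposition: `K^{*1} = K` and `K^{*(n+1)} = K^{*n} * K` for `n ≥ 1`.
By convention (never used below) `K^{*0}` is the class of finite sets. -/
def starPow {L₀ : FirstOrder.Language.{0, 0}} (K : Set (Bundled.{0} L₀.Structure)) :
    (n : ℕ) → Set (Bundled.{0} (starLang L₀ n).Structure)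
  | 0 => {A | Finite A}
  | 1 => K
  | n + 2 => freeSuperposition (starPow K (n + 1)) K

/-! ### Target side: saturated models, types, configurations and ranks -/

section Target

universe u v w

variable {L : FirstOrder.Language.{u, v}} {M : Type w} [L.Structure M]

/-- `M` is `ℵ₁`-saturated: for every countable `A ⊆ M`, every set of `L(A)`-formulas in one
variable that is finitely satisfiable in `M` is realized in `M`. -/
def IsAlephOneSaturated (L : FirstOrder.Language.{u, v}) (M : Type w) [L.Structure M] : Prop :=
  ∀ A : Set M, A.Countable → ∀ p : Set (L[[A]].Formula Unit),
    (∀ q : Set (L[[A]].Formula Unit), q ⊆ p → q.Finite →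
      ∃ b : M, ∀ φ ∈ q, φ.Realize (fun _ => b)) →
    ∃ b : M, ∀ φ ∈ p, φ.Realize (fun _ => b)

/-- The set `π(M)` of realizations in `M` of a set `π` of `L(M)`-formulas in the variables
indexed by `β`. -/
def realizations {β : Type} (π : Set (L[[M]].Formula β)) : Set (β → M) :=
  {b | ∀ φ ∈ π, φ.Realize b}

/-- The function `f : Γ → π(M)` codes every relation of `Γ` by an `L(M)`-formula: for each
`k`-ary relation symbol `R` there is an `L(M)`-formula `φ` in `k` copies of the variables of `π`
such that `Γ ⊨ R(a)` if and only if `M ⊨ φ(f(a))`. -/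
def IsConfiguration {L₀ : FirstOrder.Language.{0, 0}} {β : Type} (π : Set (L[[M]].Formula β))
    {Γ : Type} [L₀.Structure Γ] (f : Γ → β → M) : Prop :=
  (∀ g : Γ, f g ∈ realizations π) ∧
    ∀ (k : ℕ) (R : L₀.Relations k), ∃ φ : L[[M]].Formula (Fin k × β),
      ∀ a : Fin k → Γ, RelMap R a ↔ φ.Realize (fun p => f (a p.1) p.2)

/-- There is a `K`-configuration into `π`, that is, a function from the Fraïssé limit of `K`
to `π(M)` as in `IsConfiguration`. -/
def ExistsConfiguration {L₀ : FirstOrder.Language.{0, 0}} [L₀.IsRelational]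
    (K : Set (Bundled.{0} L₀.Structure)) {β : Type} (π : Set (L[[M]].Formula β)) : Prop :=
  ∃ (Γ : Type) (_ : L₀.Structure Γ) (_ : Countable Γ), IsFraisseLimit K Γ ∧
    ∃ f : Γ → β → M, IsConfiguration (L₀ := L₀) π f

/-- `π` has `K`-rank `r`, where `r ∈ {0, 1, 2, …, ∞}`. -/
def HasRank {L₀ : FirstOrder.Language.{0, 0}} [L₀.IsRelational]
    (K : Set (Bundled.{0} L₀.Structure)) {β : Type} (π : Set (L[[M]].Formula β))
    (r : ℕ∞) : Prop :=
  (r = 0 ∧ ¬ ExistsConfiguration K π) ∨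
  (∃ n : ℕ, 1 ≤ n ∧ r = n ∧
    ExistsConfiguration (starPow K n) π ∧ ¬ ExistsConfiguration (starPow K (n + 1)) π) ∨
  (r = ⊤ ∧ ∀ n : ℕ, 1 ≤ n → ExistsConfiguration (starPow K n) π)

/-- The partial type `y = y` in an `n`-tuple `y` of variables. -/
def trivialType (L : FirstOrder.Language.{u, v}) (M : Type w) (n : ℕ) :
    Set (L[[M]].Formula (Fin n)) :=
  Set.range fun i : Fin n => Term.equal (Term.var i) (Term.var i)

end Target

/-! ### The theory of the random graph -/

/-- The extension axiom: for all `x₀, …, x_{k-1}` and `y₀, …, y_{l-1}` with every `x_i` different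
from every `y_j`, there is `z` adjacent to every `x_i`, and different from and not adjacent to
every `y_j`. -/
noncomputable def extensionAxiom (k l : ℕ) : Language.graph.Sentence :=
  Formula.iAlls (α := Empty) (Fin k ⊕ Fin l) <|
    (Formula.iInf fun p : Fin k × Fin l =>
      ∼(Term.equal (Term.var (Sum.inr (Sum.inl p.1))) (Term.var (Sum.inr (Sum.inr p.2))))).imp <|
    Formula.iExs Unit <|
      (Formula.iInf fun i : Fin k =>
        adj.formula₂ (Term.var (Sum.inr ())) (Term.var (Sum.inl (Sum.inr (Sum.inl i))))) ⊓
      (Formula.iInf fun j : Fin l =>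
        ∼(Term.equal (Term.var (Sum.inr ())) (Term.var (Sum.inl (Sum.inr (Sum.inr j))))) ⊓
        ∼(adj.formula₂ (Term.var (Sum.inr ())) (Term.var (Sum.inl (Sum.inr (Sum.inr j))))))

/-- The theory of the random graph: the axioms of graphs and all extension axioms. -/
def randomGraphTheory : Language.graph.Theory :=
  Theory.simpleGraph ∪ {σ | ∃ k l : ℕ, σ = extensionAxiom k l}

theorem realize_extensionAxiom {M : Type*} [Language.graph.Structure M] (k l : ℕ) :
    M ⊨ extensionAxiom k l ↔ ∀ (x : Fin k → M) (y : Fin l → M), (∀ i j, x i ≠ y j) →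
      ∃ z : M, (∀ i, RelMap adj ![z, x i]) ∧ ∀ j, z ≠ y j ∧ ¬ RelMap adj ![z, y j] := by
  unfold extensionAxiom Sentence.Realize
  rw [Formula.realize_iAlls]
  constructor
  · intro h x y hxy
    have := h (Sum.elim x y)
    simp only [Formula.realize_imp, Formula.realize_iInf, Formula.realize_iExs] at this
    obtain ⟨z, hz⟩ := this (by simpa [Formula.realize_not] using hxy)
    refine ⟨z (), ?_⟩
    simpa [Formula.realize_inf, Formula.realize_iInf, Formula.realize_not,
      Formula.realize_rel₂] using hz
  · intro h v
    simp only [Formula.realize_imp, Formula.realize_iInf, Formula.realize_iExs]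
    intro hv
    obtain ⟨z, hz⟩ := h (fun i => v (Sum.inl i)) (fun j => v (Sum.inr j))
      (by simpa [Formula.realize_not] using hv)
    refine ⟨fun _ => z, ?_⟩
    simpa [Formula.realize_inf, Formula.realize_iInf, Formula.realize_not,
      Formula.realize_rel₂] using hz

end KRank

/-!
The adjacencies between two `n`-tuples of vertices form an `n × n` matrix of truth values, and
swapping the tuples transposes it. In the Fraïssé limit of `K^{*m}` the type of a pair of distinct
points is one of the `2 ^ m` subsets of the `m` relations, and swapping the points complements the
type for orders and tournaments and preserves it for graphs. By the extension axioms and quantifier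
elimination, a configuration exists if the types can be coded by matrices, injectively and
compatibly with swapping. Conversely, by Ramsey arguments every configuration can be thinned out to
one in which the matrix of a pair determines its type, which gives such a code. Hence `m ≤ n ^ 2`.
If `m = n ^ 2`, then every matrix is a code: symmetric matrices exclude orders and tournaments,
nonsymmetric ones (which exist for `n ≥ 2`) exclude graphs. For `m < n ^ 2` there is a code.
-/

namespace KRank

open FirstOrder FirstOrder.Language FirstOrder.Language.Structure CategoryTheory

/-! ### Linear orders, tournaments and graphs -/

/-- The three kinds of binary relation whose ranks are computed. -/
inductive RelKind
  | linearOrder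
  | tournament
  | graph

/-- `IsOfKind c r` says that `r` is a strict linear order, a tournament or a graph, according to
`c`. In all three cases `r a b` determines `r b a` for distinct `a` and `b`. -/
structure IsOfKind (c : RelKind) {A : Type*} (r : A → A → Prop) : Prop where
  irrefl : ∀ a, ¬ r a a
  swap : ∀ {a b}, a ≠ b → (r b a ↔ (r a b ↔ c = .graph))
  trans : c = .linearOrder → ∀ {a b d}, r a b → r b d → r a d

namespace IsOfKind

variable {c : RelKind} {A B : Type*}

theorem comap {s : B → B → Prop} (hs : IsOfKind c s) {e : A → B} (he : Function.Injective e) :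
    IsOfKind c (fun a b => s (e a) (e b)) where
  irrefl _ := hs.irrefl _
  swap h := hs.swap (he.ne h)
  trans hc _ _ _ := hs.trans hc

theorem linearOrder_iff {r : A → A → Prop} :
    IsOfKind .linearOrder r ↔ (∀ a b, a ≠ b → (r b a ↔ ¬ r a b)) ∧ (∀ a, ¬ r a a) ∧
      ∀ a b d, r a b → r b d → r a d :=
  ⟨fun h => ⟨fun _ _ hab => by simpa using h.swap hab, h.irrefl, fun _ _ _ => h.trans rfl⟩,
    fun ⟨hs, hi, ht⟩ => ⟨hi, fun hab => by simpa using hs _ _ hab, fun _ => ht _ _ _⟩⟩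

theorem tournament_iff {r : A → A → Prop} :
    IsOfKind .tournament r ↔ (∀ a b, a ≠ b → (r b a ↔ ¬ r a b)) ∧ ∀ a, ¬ r a a :=
  ⟨fun h => ⟨fun _ _ hab => by simpa using h.swap hab, h.irrefl⟩,
    fun ⟨hs, hi⟩ => ⟨hi, fun hab => by simpa using hs _ _ hab, nofun⟩⟩

theorem graph_iff {r : A → A → Prop} :
    IsOfKind .graph r ↔ (∀ a b, r a b → r b a) ∧ ∀ a, ¬ r a a := by
  refine ⟨fun h => ⟨fun a b hab => ?_, h.irrefl⟩,
    fun ⟨hs, hi⟩ => ⟨hi, fun _ => by simpa using ⟨hs _ _, hs _ _⟩, nofun⟩⟩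
  have hne : a ≠ b := by
    rintro rfl
    exact h.irrefl a hab
  exact (h.swap hne).2 (by simpa using hab)

end IsOfKind

theorem exists_isOfKind (c : RelKind) (A : Type*) : ∃ r : A → A → Prop, IsOfKind c r := by
  by_cases hc : c = .graph
  · exact ⟨fun _ _ => False, fun _ => id, by simp [hc], by simp⟩
  · refine ⟨WellOrderingRel, _root_.irrefl, fun {a b} hab => ?_, fun _ _ _ _ => _root_.trans⟩
    simp only [hc, iff_false]
    exact ⟨asymm, fun h => ((trichotomous_of WellOrderingRel a b).resolve_left h).resolve_left hab⟩

theorem IsOfKind.prodLex {c : RelKind} {A D : Type*} {r : A → A → Prop} {s : D → D → Prop}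
    (hr : IsOfKind c r) (hs : IsOfKind c s) : IsOfKind c (Prod.Lex r s) where
  irrefl x := by simp [Prod.lex_def, hr.irrefl, hs.irrefl]
  swap {x y} hxy := by
    by_cases h : x.1 = y.1
    · simpa [Prod.lex_def, h, hr.irrefl] using hs.swap fun h' => hxy (Prod.ext h h')
    · simpa [Prod.lex_def, h, Ne.symm h] using hr.swap h
  trans hc x y z := by
    simp only [Prod.lex_def]
    rintro (h | ⟨h, h'⟩) (k | ⟨k, k'⟩)
    · exact .inl (hr.trans hc h k)
    · exact .inl (k ▸ h)
    · exact .inl (h ▸ k)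
    · exact .inr ⟨h.trans k, hs.trans hc h' k'⟩

theorem exists_isOfKind_bool (c : RelKind) (p : Prop) :
    ∃ r : Bool → Bool → Prop, IsOfKind c r ∧ (r false true ↔ p) := by
  refine ⟨fun a b => (a = false ∧ b = true ∧ p) ∨ (a = true ∧ b = false ∧ (p ↔ c = .graph)),
    ⟨?_, ?_, ?_⟩, by simp⟩
  · simp
  · rintro (_ | _) (_ | _) h <;> simp_all
    tauto
  · rintro rfl (_ | _) (_ | _) (_ | _) <;> simp

/-- The binary relation on `A` named by a binary relation symbol. -/
abbrev binRel {L : FirstOrder.Language} {A : Type*} [L.Structure A] (R : L.Relations 2) (a b : A) :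
    Prop :=
  RelMap R ![a, b]

section Classes

theorem perm_fin_two_eq_or (σ : Equiv.Perm (Fin 2)) : σ = 1 ∨ σ = Equiv.swap 0 1 := by
  decide +revert

theorem forall_fin_two_fun {A : Type*} {p : (Fin 2 → A) → Prop} :
    (∀ a, p a) ↔ ∀ a b, p ![a, b] :=
  (finTwoArrowEquiv A).symm.surjective.forall.trans Prod.forall

theorem comp_swap_zero_one {A : Type*} (a b : A) : ![a, b] ∘ Equiv.swap 0 1 = ![b, a] := by
  ext i
  fin_cases i <;> rfl

theorem existsUnique_perm_fin_two {P : Equiv.Perm (Fin 2) → Prop} :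
    (∃! σ, P σ) ↔ (P (Equiv.swap 0 1) ↔ ¬ P 1) := by
  have hne : (1 : Equiv.Perm (Fin 2)) ≠ Equiv.swap 0 1 := by decide
  constructor
  · rintro ⟨σ, hσ, huniq⟩
    rcases perm_fin_two_eq_or σ with rfl | rfl
    · exact iff_of_false (fun h' => hne (huniq _ h').symm) (not_not_intro hσ)
    · exact iff_of_true hσ fun h' => hne (huniq _ h')
  · intro hP
    by_cases h1 : P 1
    · exact ⟨1, h1, fun τ hτ => (perm_fin_two_eq_or τ).resolve_right fun h' => hP.1 (h' ▸ hτ) h1⟩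
    · exact ⟨_, hP.2 h1, fun τ hτ => (perm_fin_two_eq_or τ).resolve_left fun h' => h1 (h' ▸ hτ)⟩

variable {L : FirstOrder.Language.{0, 0}} {A : Type} [L.Structure A] (R : L.Relations 2)

theorem relIrreflexive_iff : RelIrreflexive R A ↔ ∀ a : A, ¬ binRel R a a := by
  simp [RelIrreflexive, forall_fin_two_fun, Fin.exists_fin_two]

theorem relSymmetric_iff : RelSymmetric R A ↔ ∀ a b : A, binRel R a b → binRel R b a := by
  simp only [RelSymmetric, forall_fin_two_fun]
  refine ⟨fun h a b => by simpa only [comp_swap_zero_one] using h a b (Equiv.swap 0 1),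
    fun h a b σ => ?_⟩
  rcases perm_fin_two_eq_or σ with rfl | rfl
  · exact id
  · simpa only [comp_swap_zero_one] using h a b

theorem relTrichotomous_iff :
    RelTrichotomous R A ↔ ∀ a b : A, a ≠ b → (binRel R b a ↔ ¬ binRel R a b) := by
  simp only [RelTrichotomous, forall_fin_two_fun, existsUnique_perm_fin_two, comp_swap_zero_one]
  simp [Fin.forall_fin_two]

/-- The class of finite structures of kind `c` in the language with one binary symbol. -/
def RelKind.toClass : RelKind → Set (Bundled.{0} binLang.Structure)
  | linearOrder => LO
  | tournament => Tour
  | graph => Gr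

theorem mem_toClass_iff {c : RelKind} {A : Bundled.{0} binLang.Structure} :
    A ∈ c.toClass ↔ Finite A ∧ IsOfKind c (binRel symbE (A := A)) := by
  obtain ⟨A, _⟩ := A
  cases c
  · rw [IsOfKind.linearOrder_iff, ← relTrichotomous_iff, ← relIrreflexive_iff]
    rfl
  · rw [IsOfKind.tournament_iff, ← relTrichotomous_iff, ← relIrreflexive_iff]
    rfl
  · rw [IsOfKind.graph_iff, ← relSymmetric_iff, ← relIrreflexive_iff]
    rfl

end Classes

/-! ### Binary relational languages -/

/-- All relation symbols of `L` are binary. -/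
class HasOnlyBinaryRelations (L : FirstOrder.Language) : Prop where
  isEmpty_relations : ∀ {k}, k ≠ 2 → IsEmpty (L.Relations k)

theorem HasOnlyBinaryRelations.forall_relations {L : FirstOrder.Language}
    [HasOnlyBinaryRelations L] {p : ∀ k, L.Relations k → Prop} :
    (∀ k R, p k R) ↔ ∀ R, p 2 R := by
  refine ⟨fun h => h 2, fun h k R => ?_⟩
  rcases eq_or_ne k 2 with rfl | hk
  · exact h R
  · exact ((isEmpty_relations hk).false R).elim

instance : HasOnlyBinaryRelations binLang := ⟨fun hk => ⟨by rintro ⟨⟩; exact hk rfl⟩⟩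

instance : HasOnlyBinaryRelations Language.graph := ⟨fun hk => ⟨by rintro ⟨⟩; exact hk rfl⟩⟩

instance starLang.hasOnlyBinaryRelations (L₀ : FirstOrder.Language.{0, 0})
    [HasOnlyBinaryRelations L₀] : (m : ℕ) → HasOnlyBinaryRelations (starLang L₀ m)
  | 0 => ⟨fun _ => inferInstanceAs (IsEmpty Empty)⟩
  | 1 => inferInstanceAs (HasOnlyBinaryRelations L₀)
  | m + 2 => ⟨fun hk => isEmpty_sum.2
      ⟨(hasOnlyBinaryRelations L₀ (m + 1)).isEmpty_relations hk,
        HasOnlyBinaryRelations.isEmpty_relations hk⟩⟩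

/-- The structure in a relational language whose binary relations are given by `r`, the relations
of other arities being empty. -/
@[reducible] def structureOfRel {L : FirstOrder.Language} [L.IsRelational] {A : Type*}
    (r : L.Relations 2 → A → A → Prop) : L.Structure A where
  funMap := isEmptyElim
  RelMap {k} := match k with
    | 2 => fun R a => r R (a 0) (a 1)
    | _ => fun _ _ => False

section Embeddings

variable {L : FirstOrder.Language} {A B : Type*} [L.Structure A] [L.Structure B]

theorem comp_pair {A B : Type*} (e : A → B) (a b : A) : e ∘ ![a, b] = ![e a, e b] := by
  ext i
  fin_cases i <;> rfl

theorem binRel_embedding (e : A ↪[L] B) (R : L.Relations 2) (a b : A) :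
    binRel R (e a) (e b) ↔ binRel R a b := by
  rw [binRel, ← comp_pair, e.map_rel]

theorem IsOfKind.of_embedding {c : RelKind} {R : L.Relations 2} (h : IsOfKind c (binRel (A := B) R))
    (e : A ↪[L] B) : IsOfKind c (binRel (A := A) R) := by
  have := h.comap e.injective
  simp only [binRel_embedding] at this
  exact this

/-- In a binary relational language, an injective map that preserves and reflects the binary
relations is an embedding. -/
def embeddingOfBinRel [L.IsRelational] [HasOnlyBinaryRelations L] (e : A ↪ B)
    (h : ∀ (R : L.Relations 2) a b, binRel R (e a) (e b) ↔ binRel R a b) : A ↪[L] B where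
  toEmbedding := e
  map_fun' := isEmptyElim
  map_rel' {k} R a := HasOnlyBinaryRelations.forall_relations
    (p := fun _ R => ∀ a, RelMap R (e ∘ a) ↔ RelMap R a).2
    (fun R => forall_fin_two_fun.2 fun a b => comp_pair e a b ▸ h R a b) k R a

end Embeddings

/-- The finite structures all of whose binary relations are of kind `c`. -/
def RelKind.structures (c : RelKind) (L₀ : FirstOrder.Language.{0, 0}) :
    Set (Bundled.{0} L₀.Structure) :=
  {A | Finite A ∧ ∀ R : L₀.Relations 2, IsOfKind c (binRel (A := A) R)}

theorem toClass_eq_structures (c : RelKind) : c.toClass = c.structures binLang := by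
  ext A
  refine mem_toClass_iff.trans (and_congr_right' ⟨?_, fun h => h symbE⟩)
  rintro h ⟨⟩
  exact h

theorem freeSuperposition_structures (c : RelKind) (L₀ L₁ : FirstOrder.Language.{0, 0}) :
    freeSuperposition (c.structures L₀) (c.structures L₁) = c.structures (L₀.sum L₁) := by
  ext A
  refine ⟨fun ⟨hA, h₀, h₁⟩ => ⟨hA, Sum.rec h₀.2 h₁.2⟩,
    fun ⟨hA, h⟩ => ⟨hA, ⟨hA, fun R => h (.inl R)⟩, hA, fun R => h (.inr R)⟩⟩

theorem starPow_toClass (c : RelKind) :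
    (m : ℕ) → starPow c.toClass m = c.structures (starLang binLang m)
  | 0 => Set.ext fun _ => (and_iff_left (fun R : Empty => R.elim)).symm
  | 1 => toClass_eq_structures c
  | m + 2 => by
    rw [starPow, starPow_toClass c (m + 1), toClass_eq_structures, freeSuperposition_structures]
    rfl

theorem nonempty_relations_starLang_equiv :
    (m : ℕ) → Nonempty ((starLang binLang m).Relations 2 ≃ Fin m)
  | 0 => ⟨Equiv.equivOfIsEmpty Empty (Fin 0)⟩
  | 1 => ⟨⟨fun _ => 0, fun _ => symbE, by rintro ⟨⟩; rfl, fun _ => (Subsingleton.elim _ _)⟩⟩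
  | m + 2 =>
    have ⟨e⟩ := nonempty_relations_starLang_equiv (m + 1)
    have ⟨e'⟩ := nonempty_relations_starLang_equiv 1
    ⟨(Equiv.sumCongr e e').trans finSumFinEquiv⟩

instance (m : ℕ) : Finite ((starLang binLang m).Relations 2) :=
  have ⟨e⟩ := nonempty_relations_starLang_equiv m
  .of_equiv _ e.symm

theorem card_relations_starLang (m : ℕ) : Nat.card ((starLang binLang m).Relations 2) = m := by
  obtain ⟨e⟩ := nonempty_relations_starLang_equiv m
  simp [Nat.card_congr e]

/-! ### Types of tuples -/

section SameType

variable {κ A B C I J : Type*} {r : κ → A → A → Prop} {s : κ → B → B → Prop}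

/-- The tuples `u` and `w` have the same quantifier-free type with respect to the families of
binary relations `r` and `s`. -/
def SameType (r : κ → A → A → Prop) (s : κ → B → B → Prop) (u : I → A) (w : I → B) : Prop :=
  ∀ p q, (u p = u q ↔ w p = w q) ∧ ∀ k, r k (u p) (u q) ↔ s k (w p) (w q)

theorem SameType.symm {u : I → A} {w : I → B} (h : SameType r s u w) : SameType s r w u :=
  fun p q => ⟨(h p q).1.symm, fun k => ((h p q).2 k).symm⟩

theorem SameType.comp {u : I → A} {w : I → B} (h : SameType r s u w) (e : J → I) :
    SameType r s (u ∘ e) (w ∘ e) :=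
  fun _ _ => h _ _

/-- Every finite tuple realized in `(A, r)` and in `(B, s)` with the same type has, for each
one-point extension in `A`, a corresponding one-point extension in `B`. -/
def ExtendsTypes (r : κ → A → A → Prop) (s : κ → B → B → Prop) : Prop :=
  ∀ l (u : Fin l → A) (w : Fin l → B), SameType r s u w →
    ∀ a, ∃ b, SameType r s (Option.elim' a u) (Option.elim' b w)

theorem ExtendsTypes.exists_sameType (h : ExtendsTypes r s) [Finite I] {u : I → A} {w : I → B}
    (huw : SameType r s u w) (a : A) :
    ∃ b, SameType r s (Option.elim' a u) (Option.elim' b w) := by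
  obtain ⟨l, ⟨e⟩⟩ := Finite.exists_equiv_fin I
  obtain ⟨b, hb⟩ := h l _ _ (huw.comp e.symm) a
  refine ⟨b, ?_⟩
  convert hb.comp (Option.map e) using 1 <;>
  · ext (_ | p) <;> simp

theorem ExtendsTypes.of_isOfKind {c : RelKind} (hr : ∀ k, IsOfKind c (r k))
    (hs : ∀ k, IsOfKind c (s k))
    (h : ∀ l (u : Fin l → A) (w : Fin l → B), SameType r s u w → ∀ a, (∀ p, u p ≠ a) →
      ∃ b, (∀ p, w p ≠ b) ∧ ∀ k p, r k (u p) a ↔ s k (w p) b) :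
    ExtendsTypes r s := by
  intro l u w huw a
  by_cases ha : ∃ p, u p = a
  · obtain ⟨p, rfl⟩ := ha
    refine ⟨w p, ?_⟩
    convert huw.comp (fun o : Option (Fin l) => o.elim p id) using 1 <;>
    · ext (_ | q) <;> simp
  · push Not at ha
    obtain ⟨b, hb, hrs⟩ := h l u w huw a ha
    refine ⟨b, ?_⟩
    rintro (_ | p) (_ | q)
    · simp [(hr _).irrefl, (hs _).irrefl]
    · simp [(ha q).symm, (hb q).symm, (hr _).swap (ha q), (hs _).swap (hb q), hrs]
    · simp [ha p, hb p, hrs]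
    · exact huw p q

end SameType

section BackAndForth

theorem exists_eq_var {L : FirstOrder.Language} [L.IsRelational] {α : Type*} (t : L.Term α) :
    ∃ p, t = .var p :=
  match t with
  | .var p => ⟨p, rfl⟩
  | .func f _ => isEmptyElim f

theorem sumElim_snoc {γ X : Type*} {n : ℕ} (v : γ → X) (xs : Fin n → X) (x : X) :
    Sum.elim v (Fin.snoc xs x : Fin (n + 1) → X) = Option.elim' x (Sum.elim v xs) ∘
      Sum.elim (some ∘ Sum.inl) (Fin.snoc (some ∘ Sum.inr) none : Fin (n + 1) → _) := by
  ext (p | p)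
  · rfl
  · induction p using Fin.lastCases <;> simp

variable {L : FirstOrder.Language} [HasOnlyBinaryRelations L] {A B : Type*} [L.Structure A]
  [L.Structure B]

theorem SameType.relMap_iff {I : Type*} {u : I → A} {w : I → B}
    (h : SameType (binRel (L := L)) binRel u w) {n : ℕ} (R : L.Relations n) (σ : Fin n → I) :
    RelMap R (u ∘ σ) ↔ RelMap R (w ∘ σ) :=
  HasOnlyBinaryRelations.forall_relations
    (p := fun _ R => ∀ σ, RelMap R (u ∘ σ) ↔ RelMap R (w ∘ σ)).2
    (fun R => forall_fin_two_fun.2 fun p q => by simpa only [comp_pair] using (h p q).2 R) n R σ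

variable [L.IsRelational]

/-- Quantifier elimination, in the form of a back-and-forth argument. -/
theorem SameType.realize_iff (hAB : ExtendsTypes (binRel (L := L) (A := A)) (binRel (A := B)))
    (hBA : ExtendsTypes (binRel (L := L) (A := B)) (binRel (A := A))) {γ : Type*} [Finite γ]
    {k : ℕ} (φ : L.BoundedFormula γ k) {v : γ → A} {w : γ → B} {xs : Fin k → A} {ys : Fin k → B}
    (h : SameType (binRel (L := L)) binRel (Sum.elim v xs) (Sum.elim w ys)) :
    φ.Realize v xs ↔ φ.Realize w ys := by
  induction φ with
  | falsum => rfl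
  | equal t₁ t₂ =>
    obtain ⟨p, rfl⟩ := exists_eq_var t₁
    obtain ⟨q, rfl⟩ := exists_eq_var t₂
    exact (h p q).1
  | rel R ts =>
    choose σ hσ using fun i => exists_eq_var (ts i)
    obtain rfl : ts = fun i => .var (σ i) := funext hσ
    exact h.relMap_iff R σ
  | imp _ _ ih₁ ih₂ => exact imp_congr (ih₁ h) (ih₂ h)
  | all φ ih =>
    refine ⟨fun hφ b => ?_, fun hφ a => ?_⟩
    · obtain ⟨a, hab⟩ := hBA.exists_sameType h.symm b
      refine (ih ?_).1 (hφ a)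
      rw [sumElim_snoc v, sumElim_snoc w]
      exact hab.symm.comp _
    · obtain ⟨b, hab⟩ := hAB.exists_sameType h a
      refine (ih ?_).2 (hφ b)
      rw [sumElim_snoc v, sumElim_snoc w]
      exact hab.comp _

theorem exists_finset_realize_iff (hA : ExtendsTypes (binRel (L := L) (A := A)) (binRel (A := A)))
    {α : Type*} [Finite α] (φ : L[[A]].Formula α) :
    ∃ F : Finset A, ∀ v w : α → A,
      SameType (binRel (L := L)) binRel (Sum.elim ((↑) : F → A) v) (Sum.elim (↑) w) →
        (φ.Realize v ↔ φ.Realize w) := by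
  classical
  let ψ := BoundedFormula.constantsVarsEquiv φ
  let f : ψ.freeVarFinset → ψ.freeVarFinset.toLeft ⊕ α
    | ⟨.inl a, ha⟩ => .inl ⟨a, Finset.mem_toLeft.2 ha⟩
    | ⟨.inr p, _⟩ => .inr p
  have realize_f (v : α → A) :
      φ.Realize v ↔ (ψ.restrictFreeVar f).Realize (Sum.elim (↑) v) default := by
    rw [BoundedFormula.realize_restrictFreeVar (Sum.elim id v) (by rintro ⟨a | p, _⟩ <;> rfl)]
    exact BoundedFormula.realize_constantsVarsEquiv.symm
  refine ⟨ψ.freeVarFinset.toLeft, fun v w h => ?_⟩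
  rw [realize_f, realize_f]
  refine SameType.realize_iff hA hA _ ?_
  rintro (p | p) (q | q)
  · exact h p q
  · exact q.elim0
  · exact p.elim0
  · exact p.elim0

theorem isExtensionPair_of_extendsTypes
    (h : ExtendsTypes (binRel (L := L) (A := A)) (binRel (A := B))) : L.IsExtensionPair A B := by
  rw [isExtensionPair_iff_exists_embedding_closure_singleton_sup]
  intro S hS f m
  have : Finite S := (S.fg_iff_structure_fg.1 hS).finite
  have hf : SameType (binRel (L := L)) binRel ((↑) : S → A) f := fun p q =>
    ⟨Subtype.coe_inj.trans f.injective.eq_iff.symm, fun R =>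
      (binRel_embedding S.subtype R p q).trans (binRel_embedding f R p q).symm⟩
  obtain ⟨b, hb⟩ := h.exists_sameType hf m
  have exists_index (x : (Substructure.closure L {m} ⊔ S : L.Substructure A)) :
      ∃ o : Option S, Option.elim' m (↑) o = (x : A) := by
    obtain ⟨x, hx⟩ := x
    rw [← S.closure_eq, ← Substructure.closure_union,
      Substructure.mem_closure_iff_of_isRelational] at hx
    rcases hx with rfl | hx
    · exact ⟨none, rfl⟩
    · exact ⟨some ⟨x, hx⟩, rfl⟩
  choose σ hσ using exists_index
  let g : (Substructure.closure L {m} ⊔ S : L.Substructure A) ↪[L] B := embeddingOfBinRel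
    ⟨fun x => Option.elim' b f (σ x), fun x y hxy => by
      simpa only [hσ, Subtype.coe_inj] using (hb (σ x) (σ y)).1.2 hxy⟩
    (fun R x y => ((hb (σ x) (σ y)).2 R).symm.trans <| by
      rw [hσ, hσ]
      exact binRel_embedding (Substructure.subtype _) R x y)
  refine ⟨g, Embedding.ext fun s => (hb (some s) (σ _)).1.1 (hσ (Substructure.inclusion _ s)).symm⟩

theorem nonempty_embedding_of_extendsTypes [Countable A]
    (h : ExtendsTypes (binRel (L := L) (A := A)) (binRel (A := B))) : Nonempty (A ↪[L] B) := by
  have : IsEmpty (L.Relations 0) := HasOnlyBinaryRelations.isEmpty_relations two_ne_zero.symm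
  obtain ⟨f, -⟩ := embedding_from_cg Structure.cg_of_countable (default : L.FGEquiv A B)
    (isExtensionPair_of_extendsTypes h)
  exact ⟨f⟩

end BackAndForth

/-! ### Generic relations -/

/-- A relation of kind `c` on `ℕ` built from prescribed sets: each `b` is preceded by the smaller
numbers in `T b`, and, for linear orders, by the smaller numbers that precede one of those. -/
def genericRel (c : RelKind) (T : ℕ → Finset ℕ) (a b : ℕ) : Prop :=
  if a < b then a ∈ T b ∨ (c = .linearOrder ∧ ∃ x, ∃ _ : x < b, x ∈ T b ∧ genericRel c T a x)
  else if b < a then (genericRel c T b a ↔ c = .graph)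
  else False
termination_by max a b + a

section Generic

variable {c : RelKind} {T : ℕ → Finset ℕ} {a b : ℕ}

theorem genericRel_of_lt (hab : a < b) :
    genericRel c T a b ↔
      a ∈ T b ∨ (c = .linearOrder ∧ ∃ x < b, x ∈ T b ∧ genericRel c T a x) := by
  rw [genericRel, if_pos hab]
  simp only [exists_prop]

theorem genericRel_self : ¬ genericRel c T a a := by
  simp [genericRel]

theorem genericRel_of_gt (hab : a < b) :
    genericRel c T b a ↔ (genericRel c T a b ↔ c = .graph) := by
  rw [genericRel, if_neg hab.asymm, if_pos hab]

theorem genericRel_swap (hab : a ≠ b) :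
    genericRel c T b a ↔ (genericRel c T a b ↔ c = .graph) := by
  rcases hab.lt_or_gt with h | h
  · exact genericRel_of_gt h
  · rw [genericRel_of_gt h]
    tauto

theorem not_genericRel_swap (hc : c = .linearOrder) (h : genericRel c T a b) :
    ¬ genericRel c T b a := by
  have hab : a ≠ b := by
    rintro rfl
    exact genericRel_self h
  simpa [genericRel_swap hab, hc] using h

theorem genericRel_or_swap (hc : c = .linearOrder) (hab : a ≠ b) :
    genericRel c T a b ∨ genericRel c T b a := by
  simp [genericRel_swap hab, hc, em]

theorem no_genericRel_cycle (hc : c = .linearOrder) :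
    ∀ N, ∀ x < N, ∀ y < N, ∀ z < N, genericRel c T x y → genericRel c T y z →
      ¬ genericRel c T z x
  | 0 => by simp
  | N + 1 => by
    have ih := no_genericRel_cycle hc N
    have no_cycle_at_max {x y} (hx : x < N) (hy : y < N) (hxy : genericRel c T x y)
        (hyN : genericRel c T y N) : ¬ genericRel c T N x := by
      apply not_genericRel_swap hc
      obtain ⟨z, hz, hzN, hxz⟩ : ∃ z < N, z ∈ T N ∧ (x = z ∨ genericRel c T x z) := by
        rcases (genericRel_of_lt hy).1 hyN with hyN | ⟨-, z, hz, hzN, hyz⟩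
        · exact ⟨y, hy, hyN, .inr hxy⟩
        · refine ⟨z, hz, hzN, or_iff_not_imp_left.2 fun hxz => ?_⟩
          exact (genericRel_or_swap hc hxz).resolve_right (ih x hx y hy z hz hxy hyz)
      rw [genericRel_of_lt hx]
      rcases hxz with rfl | hxz
      · exact .inl hzN
      · exact .inr ⟨hc, z, hz, hzN, hxz⟩
    intro x hx y hy z hz hxy hyz hzx
    have ne_of_rel {a b} (h : genericRel c T a b) : a ≠ b := by
      rintro rfl
      exact genericRel_self h
    have := ne_of_rel hxy
    have := ne_of_rel hyz
    have := ne_of_rel hzx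
    rcases eq_or_ne x N with rfl | hxN
    · exact no_cycle_at_max (by lia) (by lia) hyz hzx hxy
    rcases eq_or_ne y N with rfl | hyN
    · exact no_cycle_at_max (by lia) (by lia) hzx hxy hyz
    rcases eq_or_ne z N with rfl | hzN
    · exact no_cycle_at_max (by lia) (by lia) hxy hyz hzx
    exact ih x (by lia) y (by lia) z (by lia) hxy hyz hzx

theorem isOfKind_genericRel : IsOfKind c (genericRel c T) where
  irrefl _ := genericRel_self
  swap := genericRel_swap
  trans hc a b d hab hbd := by
    have hne : a ≠ d := by
      rintro rfl
      exact not_genericRel_swap hc hab hbd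
    refine (genericRel_or_swap hc hne).resolve_right ?_
    exact no_genericRel_cycle hc (max a (max b d) + 1) a (by lia) b (by lia) d (by lia) hab hbd

end Generic

theorem exists_enumeration (α : Type*) [Countable α] [Nonempty α] :
    ∃ T : ℕ → α, ∀ S n, ∃ m, n ≤ m ∧ T m = S := by
  obtain ⟨f, hf⟩ := exists_surjective_nat α
  refine ⟨fun m => f m.unpair.1, fun S n => ?_⟩
  obtain ⟨i, rfl⟩ := hf S
  exact ⟨Nat.pair i n, Nat.right_le_pair i n, by simp⟩

theorem exists_generic (c : RelKind) (κ : Type) [Finite κ] :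
    ∃ R : κ → ℕ → ℕ → Prop, (∀ k, IsOfKind c (R k)) ∧
      ∀ (A : Type) (r : κ → A → A → Prop), (∀ k, IsOfKind c (r k)) → ExtendsTypes r R := by
  obtain ⟨T, hT⟩ := exists_enumeration (κ → Finset ℕ)
  refine ⟨fun k => genericRel c (T · k), fun k => isOfKind_genericRel, fun A r hr => ?_⟩
  refine .of_isOfKind hr (fun k => isOfKind_genericRel) fun l u w huw a _ => ?_
  classical
  obtain ⟨b, hb, hTb⟩ := hT (fun k => (Finset.univ.filter fun p => r k (u p) a).image w)
    (Finset.univ.sup w + 1)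
  have hlt (p) : w p < b := (Finset.le_sup (Finset.mem_univ p)).trans_lt hb
  refine ⟨b, fun p => (hlt p).ne, fun k p => ?_⟩
  have mem_iff (x : ℕ) : x ∈ T b k ↔ ∃ q, r k (u q) a ∧ w q = x := by simp [hTb]
  rw [genericRel_of_lt (hlt p), mem_iff]
  constructor
  · exact fun h => .inl ⟨p, h, rfl⟩
  · rintro (⟨q, hq, hqp⟩ | ⟨hc, x, -, hx, hpx⟩)
    · rwa [(huw p q).1.2 hqp.symm]
    · obtain ⟨q, hq, rfl⟩ := (mem_iff x).1 hx
      exact (hr k).trans hc (((huw p q).2 k).2 hpx) hq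

theorem exists_isFraisseLimit (c : RelKind) (L : FirstOrder.Language.{0, 0}) [L.IsRelational]
    [HasOnlyBinaryRelations L] [Finite (L.Relations 2)] :
    ∃ _ : L.Structure ℕ, IsFraisseLimit (c.structures L) ℕ ∧
      ∀ k, IsOfKind c (binRel (L := L) (A := ℕ) k) := by
  obtain ⟨R, hR, extends_R⟩ := exists_generic c (L.Relations 2)
  let _ : L.Structure ℕ := structureOfRel R
  refine ⟨inferInstance, ⟨
    (isUltrahomogeneous_iff_IsExtensionPair cg_of_countable).2
      (isExtensionPair_of_extendsTypes (extends_R ℕ R hR)), ?_⟩, hR⟩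
  ext A
  constructor
  · rintro ⟨hfg, ⟨f⟩⟩
    exact ⟨hfg.finite, fun k => (hR k).of_embedding f⟩
  · rintro ⟨hfin, hA⟩
    exact ⟨Structure.fg_iff_finite.2 hfin,
      nonempty_embedding_of_extendsTypes (extends_R A binRel hA)⟩

/-! ### Models of the theory of the random graph -/

section RandomGraph

variable {M : Type*} [Language.graph.Structure M]

theorem isOfKind_adj (hM : M ⊨ randomGraphTheory) (R : Language.graph.Relations 2) :
    IsOfKind .graph (binRel (A := M) R) := by
  obtain ⟨⟩ := R
  have := Theory.simpleGraph_model_iff.1 (hM.mono Set.subset_union_left)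
  exact IsOfKind.graph_iff.2 ⟨this.2.symm, this.1.irrefl⟩

theorem exists_adj_iff (hM : M ⊨ randomGraphTheory) {I : Type*} [Finite I] (w : I → M)
    (Q : I → Prop) (hQ : ∀ p q, w p = w q → (Q p ↔ Q q)) :
    ∃ z, (∀ p, w p ≠ z) ∧ ∀ p, binRel adj (w p) z ↔ Q p := by
  have hadj := isOfKind_adj hM adj
  obtain ⟨k, ⟨e⟩⟩ := Finite.exists_equiv_fin {p // Q p}
  obtain ⟨l, ⟨e'⟩⟩ := Finite.exists_equiv_fin {p // ¬ Q p}
  have hax : M ⊨ extensionAxiom k l := hM.realize_of_mem _ (.inr ⟨_, _, rfl⟩)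
  obtain ⟨z, hz, hz'⟩ := (realize_extensionAxiom _ _).1 hax (fun i => w (e.symm i))
    (fun j => w (e'.symm j)) fun i j h => (e'.symm j).2 ((hQ _ _ h).1 (e.symm i).2)
  have adj_of {p} (hp : Q p) : binRel adj z (w p) := by simpa using hz (e ⟨p, hp⟩)
  have not_adj_of {p} (hp : ¬ Q p) : z ≠ w p ∧ ¬ binRel adj z (w p) := by
    simpa using hz' (e' ⟨p, hp⟩)
  have ne_of {p} : z ≠ w p := by
    by_cases hp : Q p
    · intro h
      exact hadj.irrefl z (h ▸ adj_of hp)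
    · exact (not_adj_of hp).1
  refine ⟨z, fun p => ne_of.symm, fun p => ?_⟩
  rw [hadj.swap ne_of, iff_true_right rfl]
  exact ⟨fun h => by_contra fun hp => (not_adj_of hp).2 h, adj_of⟩

theorem extendsTypes_randomGraph (hM : M ⊨ randomGraphTheory) {A : Type*}
    {r : Language.graph.Relations 2 → A → A → Prop} (hr : ∀ R, IsOfKind .graph (r R)) :
    ExtendsTypes r (binRel (A := M)) := by
  refine .of_isOfKind hr (isOfKind_adj hM) fun l u w huw a _ => ?_
  obtain ⟨b, hb, hadj⟩ := exists_adj_iff hM w (fun p => r adj (u p) a) fun p q hpq => by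
    rw [(huw p q).1.2 hpq]
  exact ⟨b, hb, fun ⟨⟩ p => (hadj p).symm⟩

theorem exists_graph_embedding (hM : M ⊨ randomGraphTheory) {V : Type*} [Countable V]
    {r : V → V → Prop} (hr : IsOfKind .graph r) :
    ∃ e : V → M, Function.Injective e ∧ ∀ a b, binRel adj (e a) (e b) ↔ r a b := by
  let _ : Language.graph.Structure V := structureOfRel fun _ => r
  obtain ⟨f⟩ := nonempty_embedding_of_extendsTypes (L := Language.graph) (A := V)
    (extendsTypes_randomGraph hM fun _ => hr)
  exact ⟨f, f.injective, fun a b => binRel_embedding f adj a b⟩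

end RandomGraph

/-! ### Unavoidable properties -/

/-- `e` is an embedding of `A` into `B` for families of binary relations indexed by `κ`. -/
structure IsRelEmbedding {κ A B : Type*} (r : κ → A → A → Prop) (s : κ → B → B → Prop)
    (e : A → B) : Prop where
  injective : Function.Injective e
  map_rel_iff : ∀ k a b, s k (e a) (e b) ↔ r k a b

namespace IsRelEmbedding

variable {κ A B D : Type*} {r : κ → A → A → Prop} {s : κ → B → B → Prop} {t : κ → D → D → Prop}

protected theorem id : IsRelEmbedding r r id :=
  ⟨Function.injective_id, fun _ _ _ => Iff.rfl⟩

theorem comp {e' : B → D} {e : A → B} (h' : IsRelEmbedding s t e') (h : IsRelEmbedding r s e) :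
    IsRelEmbedding r t (e' ∘ e) :=
  ⟨h'.injective.comp h.injective,
    fun k a b => (h'.map_rel_iff k _ _).trans (h.map_rel_iff k a b)⟩

theorem prodLex_fiber (hr : ∀ k a, ¬ r k a a) (a : A) :
    IsRelEmbedding s (fun k => Prod.Lex (r k) (s k)) (Prod.mk a) :=
  ⟨Prod.mk_right_injective a, fun k b b' => by simp [Prod.lex_def, hr]⟩

theorem prodLex_transversal (hs : ∀ k b, ¬ s k b b) (g : A → B) :
    IsRelEmbedding r (fun k => Prod.Lex (r k) (s k)) (fun a => (a, g a)) := by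
  refine ⟨fun a a' h => (Prod.mk.inj h).1, fun k a a' => ?_⟩
  simp only [Prod.lex_def, or_iff_left_iff_imp]
  rintro ⟨rfl, h⟩
  exact (hs k _ h).elim

end IsRelEmbedding

/-- The property `P` of families in `X` is unavoidable: for each finite structure `A` of kind `c`
there is a finite structure `B` of kind `c` such that every family indexed by `B` has property `P`
on a copy of `A` in `B`. -/
def Unavoidable (c : RelKind) (κ : Type) {X : Type*} (P : ∀ I : Type, (I → X) → Prop) : Prop :=
  ∀ (A : Type) [Finite A] (r : κ → A → A → Prop), (∀ k, IsOfKind c (r k)) →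
    ∃ (B : Type) (_ : Finite B) (s : κ → B → B → Prop), (∀ k, IsOfKind c (s k)) ∧
      ∀ x : B → X, ∃ e : A → B, IsRelEmbedding r s e ∧ P A (x ∘ e)

/-- The property `P` of families passes to subfamilies. -/
def IsHereditary {X : Type*} (P : ∀ I : Type, (I → X) → Prop) : Prop :=
  ∀ {I J : Type} (x : J → X) (e : I → J), Function.Injective e → P J x → P I (x ∘ e)

namespace Unavoidable

variable {c : RelKind} {κ : Type} {X : Type*} {P Q : ∀ I : Type, (I → X) → Prop}

theorem mono (hP : Unavoidable c κ P) (h : ∀ {I : Type} (x : I → X), P I x → Q I x) :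
    Unavoidable c κ Q := by
  intro A _ r hr
  obtain ⟨B, hB, s, hs, exists_copy⟩ := hP A r hr
  exact ⟨B, hB, s, hs, fun x => (exists_copy x).imp fun _ => And.imp_right (h _)⟩

theorem and (hP : Unavoidable c κ P) (hQ : Unavoidable c κ Q) (hereditary : IsHereditary P) :
    Unavoidable c κ (fun I x => P I x ∧ Q I x) := by
  intro A _ r hr
  obtain ⟨B, _, s, hs, exists_copy_Q⟩ := hQ A r hr
  obtain ⟨D, hD, t, ht, exists_copy_P⟩ := hP B s hs
  refine ⟨D, hD, t, ht, fun x => ?_⟩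
  obtain ⟨e', he', hx'⟩ := exists_copy_P x
  obtain ⟨e, he, hx⟩ := exists_copy_Q (x ∘ e')
  exact ⟨e' ∘ e, he'.comp he, hereditary _ e he.injective hx', hx⟩

theorem forall_finset {ι : Type*} {P : ι → ∀ I : Type, (I → X) → Prop} (S : Finset ι)
    (hP : ∀ i, Unavoidable c κ (P i)) (hereditary : ∀ i, IsHereditary (P i)) :
    Unavoidable c κ (fun I x => ∀ i ∈ S, P i I x) := by
  classical
  induction S using Finset.induction_on with
  | empty => exact fun A hA r hr => ⟨A, hA, r, hr, fun x => ⟨id, .id, by simp⟩⟩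
  | insert i S _ ih =>
    simpa only [Finset.forall_mem_insert] using (hP i).and ih (hereditary i)

theorem forall_of_finite {ι : Type*} [Finite ι] {P : ι → ∀ I : Type, (I → X) → Prop}
    (hP : ∀ i, Unavoidable c κ (P i)) (hereditary : ∀ i, IsHereditary (P i)) :
    Unavoidable c κ (fun I x => ∀ i, P i I x) := by
  cases nonempty_fintype ι
  simpa using forall_finset Finset.univ hP hereditary

end Unavoidable

section Coloring

variable {c : RelKind} {κ : Type} {X : Type*}

/-- In the lexicographic square of `A`, either some fibre consists of points satisfying `q`, or
there is a transversal of points not satisfying `q`. -/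
theorem unavoidable_iff (q : X → Prop) :
    Unavoidable c κ (fun I (x : I → X) => ∀ a b, q (x a) ↔ q (x b)) := by
  intro A _ r hr
  refine ⟨A × A, inferInstance, fun k => Prod.Lex (r k) (r k), fun k => (hr k).prodLex (hr k),
    fun x => ?_⟩
  have irrefl (k : κ) := (hr k).irrefl
  by_cases h : ∃ a, ∀ b, q (x (a, b))
  · obtain ⟨a, ha⟩ := h
    exact ⟨_, .prodLex_fiber irrefl a, fun _ _ => iff_of_true (ha _) (ha _)⟩
  · push Not at h
    choose g hg using h
    exact ⟨_, .prodLex_transversal irrefl g, fun _ _ => iff_of_false (hg _) (hg _)⟩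

theorem unavoidable_color {Y : Type*} [Finite Y] (χ : X → Y) :
    Unavoidable c κ (fun I (x : I → X) => ∀ a b, χ (x a) = χ (x b)) :=
  (Unavoidable.forall_of_finite (P := fun y I (x : I → X) => ∀ a b, χ (x a) = y ↔ χ (x b) = y)
    (fun y => unavoidable_iff (χ · = y)) fun _ _ _ _ _ _ h _ _ => h _ _).mono
    fun _ h _ _ => ((h _ _ _).1 rfl).symm

/-- The family `f` is constant or injective. -/
def IsConstOrInjective {I Y : Type*} (f : I → Y) : Prop :=
  (∀ a b, f a = f b) ∨ Function.Injective f

theorem IsConstOrInjective.comp {I J Y : Type*} {f : J → Y} (hf : IsConstOrInjective f)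
    {e : I → J} (he : Function.Injective e) : IsConstOrInjective (f ∘ e) :=
  hf.imp (fun h _ _ => h _ _) fun h => h.comp he

/-- Hall's theorem, applied to the sets of values on the fibres. -/
theorem exists_transversal_injective {A D Y : Type*} [Finite A] [Finite D] {u : A × D → Y}
    (hu : ∀ a, Nat.card A ≤ (Set.range fun d => u (a, d)).ncard) :
    ∃ g : A → D, Function.Injective fun a => u (a, g a) := by
  classical
  cases nonempty_fintype A
  cases nonempty_fintype D
  let values (a : A) : Finset Y := Finset.univ.image fun d => u (a, d)
  have card_values (a : A) : Fintype.card A ≤ (values a).card := by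
    rw [← Nat.card_eq_fintype_card, ← Set.ncard_coe_finset]
    simpa [values] using hu a
  have hall (S : Finset A) : S.card ≤ (S.biUnion values).card := by
    rcases S.eq_empty_or_nonempty with rfl | ⟨a, ha⟩
    · exact Nat.zero_le _
    · calc S.card ≤ Fintype.card A := S.card_le_univ
        _ ≤ (values a).card := card_values a
        _ ≤ (S.biUnion values).card := Finset.card_le_card (Finset.subset_biUnion_of_mem values ha)
  obtain ⟨f, hf, hfu⟩ := (Finset.all_card_le_biUnion_card_iff_exists_injective values).1 hall
  choose g hg using fun a => by simpa [values] using hfu a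
  exact ⟨g, by simpa only [hg] using hf⟩

theorem unavoidable_isConstOrInjective {Y : Type*} (u : X → Y) :
    Unavoidable c κ (fun _ x => IsConstOrInjective (u ∘ x)) := by
  intro A _ r hr
  obtain ⟨D, _, s, hs, exists_monochromatic⟩ :=
    unavoidable_color (κ := κ) (c := c) (id : Fin (Nat.card A) → _) A r hr
  refine ⟨A × D, inferInstance, fun k => Prod.Lex (r k) (s k), fun k => (hr k).prodLex (hs k),
    fun x => ?_⟩
  by_cases h : ∀ a, Nat.card A ≤ (Set.range fun d => u (x (a, d))).ncard
  · obtain ⟨g, hg⟩ := exists_transversal_injective (u := u ∘ x) h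
    exact ⟨_, .prodLex_transversal (fun k => (hs k).irrefl) g, .inr hg⟩
  · push Not at h
    obtain ⟨a, ha⟩ := h
    let index : (Set.range fun d => u (x (a, d))) ↪ Fin (Nat.card A) :=
      (Finite.equivFin _).toEmbedding.trans (Fin.castLEEmb ha.le)
    obtain ⟨e, he, hmono⟩ := exists_monochromatic fun d => index ⟨_, d, rfl⟩
    refine ⟨_, (IsRelEmbedding.prodLex_fiber (fun k => (hr k).irrefl) a).comp he,
      .inl fun b b' => ?_⟩
    exact congrArg Subtype.val (index.injective (hmono b b'))

/-- The points are chosen greedily, one fibre after the other. -/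
theorem exists_transversal_of_conflict {A D : Type*} [Finite A] [Finite D]
    {C : A × D → A × D → Prop} (symm : ∀ p q, C p q → C q p) {N : ℕ}
    (hC : ∀ a q, {d | C (a, d) q}.ncard ≤ N) (hN : Nat.card A * N < Nat.card D) :
    ∃ g : A → D, ∀ a b, a ≠ b → ¬ C (a, g a) (b, g b) := by
  classical
  cases nonempty_fintype A
  cases nonempty_fintype D
  suffices exists_partial : ∀ S : Finset A, ∃ g : A → D, ∀ a ∈ S, ∀ b ∈ S, a ≠ b →
      ¬ C (a, g a) (b, g b) by
    simpa using exists_partial Finset.univ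
  intro S
  induction S using Finset.induction_on with
  | empty =>
    have : Nonempty D := Nat.card_pos_iff.1 (Nat.zero_lt_of_lt hN) |>.1
    exact ⟨fun _ => Classical.arbitrary D, by simp⟩
  | insert a S ha ih =>
    obtain ⟨g, hg⟩ := ih
    let bad : Finset D := S.biUnion fun b => {d | C (a, d) (b, g b)}
    have card_bad : bad.card < (Finset.univ : Finset D).card :=
      calc bad.card ≤ S.card * N := Finset.card_biUnion_le_card_mul _ _ _ fun b _ => by
            simpa [← Set.ncard_coe_finset] using hC a (b, g b)
        _ ≤ Nat.card A * N := by
            rw [Nat.card_eq_fintype_card]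
            exact Nat.mul_le_mul_right N S.card_le_univ
        _ < (Finset.univ : Finset D).card := by rwa [Finset.card_univ, ← Nat.card_eq_fintype_card]
    obtain ⟨d, hd⟩ : ∃ d, ∀ b ∈ S, ¬ C (a, d) (b, g b) := by
      obtain ⟨d, -, hd⟩ := Finset.exists_mem_notMem_of_card_lt_card card_bad
      exact ⟨d, by simpa [bad] using hd⟩
    have update_of_mem {b : A} (hb : b ∈ S) : Function.update g a d b = g b :=
      Function.update_of_ne (ne_of_mem_of_not_mem hb ha) _ _
    refine ⟨Function.update g a d, fun b hb b' hb' hne => ?_⟩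
    rcases Finset.mem_insert.1 hb with rfl | hbS <;>
      rcases Finset.mem_insert.1 hb' with rfl | hbS'
    · exact (hne rfl).elim
    · simpa only [Function.update_self, update_of_mem hbS'] using hd b' hbS'
    · simpa only [Function.update_self, update_of_mem hbS] using fun h => hd b hbS (symm _ _ h)
    · simpa only [update_of_mem hbS, update_of_mem hbS'] using hg b hbS b' hbS' hne

/-- The truth value of `u a = v b` is the same for all pairs of distinct indices `a`, `b`. -/
def CrossUniform {I Y : Type*} (u v : I → Y) : Prop :=
  ∀ a b a' b', a ≠ b → a' ≠ b' → (u a = v b ↔ u a' = v b')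

theorem CrossUniform.of_ne {I Y : Type*} {u v : I → Y} (h : ∀ a b, a ≠ b → u a ≠ v b) :
    CrossUniform u v :=
  fun _ _ _ _ hab hab' => iff_of_false (h _ _ hab) (h _ _ hab')

theorem CrossUniform.symm {I Y : Type*} {u v : I → Y} (h : CrossUniform u v) :
    CrossUniform v u :=
  fun _ _ _ _ hab hab' => by simpa only [eq_comm] using h _ _ _ _ hab.symm hab'.symm

theorem CrossUniform.comp {I J Y : Type*} {u v : J → Y} (h : CrossUniform u v) {e : I → J}
    (he : Function.Injective e) : CrossUniform (u ∘ e) (v ∘ e) :=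
  fun _ _ _ _ hab hab' => h _ _ _ _ (he.ne hab) (he.ne hab')

theorem exists_transversal_ne {A D Y : Type*} [Nontrivial D] {u : A × D → Y}
    (hu : Function.Injective u) (y : Y) : ∃ g : A → D, ∀ a, u (a, g a) ≠ y := by
  choose g hg using fun a => (hu.comp (Prod.mk_right_injective a)).exists_ne y
  exact ⟨g, hg⟩

theorem exists_transversal_crossUniform_of_injective {A D Y : Type*} [Finite A] [Finite D]
    (hD : Nat.card A * 2 < Nat.card D) {u v : A × D → Y} (hu : Function.Injective u)
    (hv : Function.Injective v) :
    ∃ g : A → D, CrossUniform (fun a => u (a, g a)) (fun a => v (a, g a)) := by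
  have ncard_fiber_le_one {w : A × D → Y} (hw : Function.Injective w) (a : A) (y : Y) :
      {d | w (a, d) = y}.ncard ≤ 1 :=
    (Set.ncard_le_one_iff (Set.toFinite _)).2 fun h h' =>
      (Prod.mk.inj (hw (Eq.trans h (Eq.symm h')))).2
  obtain ⟨g, hg⟩ := exists_transversal_of_conflict (C := fun p q => u p = v q ∨ v p = u q)
    (fun _ _ => Or.symm ∘ Or.imp Eq.symm Eq.symm)
    (fun a q => (Set.ncard_union_le _ _).trans
      (add_le_add (ncard_fiber_le_one hu a (v q)) (ncard_fiber_le_one hv a (u q)))) hD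
  exact ⟨g, .of_ne fun a b hab h => hg a b hab (.inl h)⟩

theorem exists_transversal_crossUniform {A D Y : Type*} [Finite A] [Finite D]
    (hD : Nat.card A * 2 + 1 < Nat.card D) {u v : A × D → Y} (hu : IsConstOrInjective u)
    (hv : IsConstOrInjective v) :
    ∃ g : A → D, CrossUniform (fun a => u (a, g a)) (fun a => v (a, g a)) := by
  have : Nontrivial D := Finite.one_lt_card_iff_nontrivial.1 (by lia)
  have const_injective {u v : A × D → Y} (hu : ∀ p q, u p = u q) (hv : Function.Injective v) :
      ∃ g : A → D, CrossUniform (fun a => u (a, g a)) (fun a => v (a, g a)) := by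
    rcases isEmpty_or_nonempty A with _ | ⟨⟨a₀⟩⟩
    · exact ⟨isEmptyElim, isEmptyElim⟩
    · let p := (a₀, Classical.arbitrary D)
      obtain ⟨g, hg⟩ := exists_transversal_ne hv (u p)
      exact ⟨g, .of_ne fun a b _ => by simpa only [hu _ p] using (hg b).symm⟩
  rcases hu with hu | hu <;> rcases hv with hv | hv
  · exact ⟨fun _ => Classical.arbitrary D,
      fun _ _ _ _ _ _ => iff_of_eq (congrArg₂ _ (hu _ _) (hv _ _))⟩
  · exact const_injective hu hv
  · exact (const_injective hv hu).imp fun _ => CrossUniform.symm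
  · exact exists_transversal_crossUniform_of_injective (by lia) hu hv

theorem unavoidable_crossUniform {Y : Type*} (u v : X → Y) :
    Unavoidable c κ (fun _ x => CrossUniform (u ∘ x) (v ∘ x)) := by
  intro A _ r hr
  let D := Fin (Nat.card A * 2 + 2)
  choose s hs using fun _ : κ => exists_isOfKind c D
  obtain ⟨B, hB, t, ht, exists_copy⟩ := (unavoidable_isConstOrInjective u).and
    (unavoidable_isConstOrInjective v) (fun _ _ he h => h.comp he) (A × D)
    (fun k => Prod.Lex (r k) (s k)) fun k => (hr k).prodLex (hs k)
  refine ⟨B, hB, t, ht, fun x => ?_⟩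
  obtain ⟨e, he, hu, hv⟩ := exists_copy x
  obtain ⟨g, hg⟩ := exists_transversal_crossUniform (by simp [D]) hu hv
  exact ⟨_, he.comp (.prodLex_transversal (fun k => (hs k).irrefl) g), hg⟩

end Coloring

theorem exists_finite_realizing_types (c : RelKind) (κ : Type) [Finite κ] :
    ∃ (A : Type) (_ : Finite A) (r : κ → A → A → Prop), (∀ k, IsOfKind c (r k)) ∧
      ∀ t : κ → Prop, ∃ a b, a ≠ b ∧ ∀ k, r k a b ↔ t k := by
  obtain ⟨R, hR, extendsTypes⟩ := exists_generic c κ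
  have exists_pair (t : κ → Prop) : ∃ a b, a ≠ b ∧ ∀ k, R k a b ↔ t k := by
    choose r hr hrt using fun k => exists_isOfKind_bool c (t k)
    have hext := extendsTypes Bool r hr
    obtain ⟨a, ha⟩ := hext 0 ![] ![] nofun false
    obtain ⟨b, hb⟩ := hext.exists_sameType ha true
    have hab := hb (some none) none
    refine ⟨a, b, fun h => ?_, fun k => (hab.2 k).symm.trans (hrt k)⟩
    exact Bool.false_ne_true (hab.1.2 h)
  choose a b hne hab using exists_pair
  refine ⟨↥(Set.range a ∪ Set.range b), inferInstance, fun k x y => R k x y,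
    fun k => (hR k).comap Subtype.val_injective, fun t => ?_⟩
  exact ⟨⟨a t, .inl ⟨t, rfl⟩⟩, ⟨b t, .inr ⟨t, rfl⟩⟩, fun h => hne t (congrArg Subtype.val h),
    hab t⟩

/-! ### Matrix codes -/

/-- The type of `(b, a)`, for distinct points `a` and `b` of a structure of kind `c`, if `(a, b)`
has type `t`. A type is given by the set of relations that hold. -/
def RelKind.swapType (c : RelKind) {κ : Type*} (t : κ → Prop) : κ → Prop :=
  fun k => t k ↔ c = .graph

theorem RelKind.swapType_swapType (c : RelKind) {κ : Type*} (t : κ → Prop) :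
    c.swapType (c.swapType t) = t := by
  ext k
  by_cases hc : c = .graph <;> simp [swapType, hc]

theorem RelKind.swapType_graph {κ : Type*} (t : κ → Prop) : RelKind.graph.swapType t = t := by
  ext k
  simp [swapType]

theorem RelKind.swapType_ne {c : RelKind} (hc : c ≠ .graph) {κ : Type*} [Nonempty κ]
    (t : κ → Prop) : c.swapType t ≠ t := by
  intro h
  have := congrFun h (Classical.arbitrary κ)
  simp [swapType, hc] at this

theorem IsOfKind.swapType_eq {c : RelKind} {κ A : Type*} {r : κ → A → A → Prop}
    (hr : ∀ k, IsOfKind c (r k)) {a b : A} (hab : a ≠ b) :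
    c.swapType (fun k => r k a b) = fun k => r k b a :=
  funext fun k => propext ((hr k).swap hab).symm

/-- `g` codes the types of ordered pairs by matrices, in such a way that a pair can be recovered,
together with its orientation, if the matrix of the pair or of the swapped pair is known. Swapping
a pair of tuples transposes their adjacency matrix. -/
def IsMatrixCode (c : RelKind) {κ ν : Type*} (g : (κ → Prop) → Matrix ν ν Prop) : Prop :=
  ∀ t t', (g t = g t' → t = t') ∧ (g t = (g t').transpose → t = c.swapType t')

/-- The matrix of adjacencies between two tuples of vertices. -/
def adjMatrix {M ν : Type*} [Language.graph.Structure M] (x y : ν → M) : Matrix ν ν Prop :=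
  .of fun i j => binRel adj (x i) (y j)

section Decode

open scoped Matrix

variable {c : RelKind} {κ ν : Type*}

/-- The matrix `N` codes `t`, or the transpose of `N` codes the swapped type. -/
def Decodes (c : RelKind) (g : (κ → Prop) → Matrix ν ν Prop) (N : Matrix ν ν Prop)
    (t : κ → Prop) : Prop :=
  g t = N ∨ g (c.swapType t) = Nᵀ

theorem IsMatrixCode.eq_of_decodes {g : (κ → Prop) → Matrix ν ν Prop} (hg : IsMatrixCode c g)
    {N : Matrix ν ν Prop} {t t' : κ → Prop} (h : Decodes c g N t) (h' : Decodes c g N t') :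
    t = t' := by
  have swap_eq {t t' : κ → Prop} (h : g t = N) (h' : g (c.swapType t') = Nᵀ) : t = t' := by
    rw [← c.swapType_swapType t']
    exact (hg _ _).2 (by rw [h, h', Matrix.transpose_transpose])
  rcases h with h | h <;> rcases h' with h' | h'
  · exact (hg _ _).1 (h.trans h'.symm)
  · exact swap_eq h h'
  · exact (swap_eq h' h).symm
  · rw [← c.swapType_swapType t, (hg _ _).1 (h.trans h'.symm), c.swapType_swapType]

theorem IsMatrixCode.exists_decodes_and_iff {g : (κ → Prop) → Matrix ν ν Prop}
    (hg : IsMatrixCode c g) {N : Matrix ν ν Prop} {t : κ → Prop} (h : Decodes c g N t)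
    {p : (κ → Prop) → Prop} : (∃ t', Decodes c g N t' ∧ p t') ↔ p t :=
  ⟨fun ⟨_, h', hp⟩ => hg.eq_of_decodes h h' ▸ hp, fun hp => ⟨t, h, hp⟩⟩

/-- The pairs of points are coded in the direction that is increasing for an auxiliary order. -/
theorem exists_matrix_decodes (g : (κ → Prop) → Matrix ν ν Prop) {A : Type*}
    {r : κ → A → A → Prop} (hr : ∀ k, IsOfKind c (r k)) :
    ∃ D : A → A → Matrix ν ν Prop, ∀ a b, a ≠ b →
      D b a = (D a b)ᵀ ∧ Decodes c g (D a b) (fun k => r k a b) := by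
  classical
  obtain ⟨lt, hlt⟩ := exists_isOfKind .linearOrder A
  have swap_lt {a b : A} (hab : a ≠ b) : lt b a ↔ ¬ lt a b := by simpa using hlt.swap hab
  refine ⟨fun a b => if lt a b then g fun k => r k a b else (g fun k => r k b a)ᵀ,
    fun a b hab => ?_⟩
  by_cases h : lt a b
  · simp [Decodes, swap_lt hab, h]
  · simp [Decodes, swap_lt hab, h, IsOfKind.swapType_eq hr hab]

end Decode

section Configurations

open scoped Matrix

variable {M : Type*} [Language.graph.Structure M] {ν : Type*}

theorem adjMatrix_transpose (hM : M ⊨ randomGraphTheory) (x y : ν → M) :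
    (adjMatrix x y)ᵀ = adjMatrix y x := by
  have adj_symm := (IsOfKind.graph_iff.1 (isOfKind_adj hM adj)).1
  ext i j
  exact ⟨adj_symm _ _, adj_symm _ _⟩

theorem exists_tuples_adjMatrix_eq (hM : M ⊨ randomGraphTheory) {V : Type*} [Countable V]
    [Countable ν] {D : V → V → Matrix ν ν Prop} (hD : ∀ a b, a ≠ b → D b a = (D a b)ᵀ) :
    ∃ f : V → ν → M, (∀ a b i, f a i = f b i ↔ a = b) ∧
      ∀ a b, a ≠ b → adjMatrix (f a) (f b) = D a b := by
  let r : V × ν → V × ν → Prop := fun x y => x.1 ≠ y.1 ∧ D x.1 y.1 x.2 y.2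
  have hr : IsOfKind .graph r := IsOfKind.graph_iff.2
    ⟨fun x y h => ⟨h.1.symm, by simpa only [hD x.1 y.1 h.1, Matrix.transpose_apply] using h.2⟩,
      fun _ h => h.1 rfl⟩
  obtain ⟨e, he, he_adj⟩ := exists_graph_embedding hM hr
  refine ⟨fun a i => e (a, i), fun a b i => by simp [he.eq_iff], fun a b hab => ?_⟩
  ext i j
  exact (he_adj _ _).trans (and_iff_right hab)

theorem exists_formula_adjMatrix [Finite ν] (Q : Matrix ν ν Prop → Prop) :
    ∃ φ : Language.graph.Formula (Fin 2 × ν), ∀ v : Fin 2 × ν → M,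
      φ.Realize v ↔ Q (adjMatrix (fun i => v (0, i)) fun j => v (1, j)) := by
  classical
  let edge (p : ν × ν) : Language.graph.Formula (Fin 2 × ν) :=
    adj.formula₂ (Term.var (0, p.1)) (Term.var (1, p.2))
  refine ⟨Formula.iSup fun N : {N // Q N} => Formula.iInf fun p : ν × ν =>
    if N.1 p.1 p.2 then edge p else ∼(edge p), fun v => ?_⟩
  have realize_edge (N : Matrix ν ν Prop) (p : ν × ν) :
      (if N p.1 p.2 then edge p else ∼(edge p)).Realize v ↔
        (N p.1 p.2 ↔ binRel adj (v (0, p.1)) (v (1, p.2))) := by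
    split_ifs with h <;> simp [h, edge, Formula.realize_rel₂, Formula.realize_not]
  simp only [Formula.realize_iSup, Formula.realize_iInf, realize_edge]
  constructor
  · rintro ⟨N, hN⟩
    convert N.2 using 1
    ext i j
    exact (hN (i, j)).symm
  · exact fun h => ⟨⟨_, h⟩, fun _ => Iff.rfl⟩

variable {c : RelKind} {L : FirstOrder.Language.{0, 0}} [L.IsRelational]
  [Finite (L.Relations 2)] {n : ℕ}

theorem existsConfiguration_of_isMatrixCode [HasOnlyBinaryRelations L]
    (hM : M ⊨ randomGraphTheory) (i₀ : Fin n)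
    {g : (L.Relations 2 → Prop) → Matrix (Fin n) (Fin n) Prop} (hg : IsMatrixCode c g) :
    ExistsConfiguration (c.structures L) (trivialType Language.graph M n) := by
  obtain ⟨_, hlim, hkind⟩ := exists_isFraisseLimit c L
  obtain ⟨D, hD⟩ := exists_matrix_decodes g hkind
  obtain ⟨f, hf, hfD⟩ := exists_tuples_adjMatrix_eq hM fun a b hab => (hD a b hab).1
  refine ⟨ℕ, _, inferInstance, hlim, f, ?_, ?_⟩
  · rintro a _ ⟨i, rfl⟩
    simp [Formula.Realize, Term.equal]
  · refine HasOnlyBinaryRelations.forall_relations.2 fun R => ?_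
    obtain ⟨φ, hφ⟩ := exists_formula_adjMatrix (M := M) (ν := Fin n) fun N =>
      ∃ t, Decodes c g N t ∧ t R
    refine ⟨(Language.graph.lhomWithConstants M).onFormula
      (∼(Term.equal (Term.var (0, i₀)) (Term.var (1, i₀))) ⊓ φ), forall_fin_two_fun.2 fun a b => ?_⟩
    rw [LHom.realize_onFormula, Formula.realize_inf, Formula.realize_not, Formula.realize_equal, hφ]
    simp only [Term.realize_var, Matrix.cons_val_zero, Matrix.cons_val_one, hf]
    by_cases hab : a = b
    · subst hab
      exact iff_of_false ((hkind R).irrefl a) fun h => h.1 rfl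
    · rw [hfD a b hab, and_iff_right hab, hg.exists_decodes_and_iff (hD a b hab).2]

theorem unavoidable_sameType {κ : Type} {κ' I A X : Type*} [Finite κ'] [Finite I]
    (r : κ' → A → A → Prop) (u : X → I → A) :
    Unavoidable c κ (fun _ x => ∀ a b, SameType r r (u (x a)) (u (x b))) := by
  let type (x : X) (p q : I) : Prop × (κ' → Prop) := (u x p = u x q, fun k => r k (u x p) (u x q))
  refine (unavoidable_color type).mono fun x h a b p q => ?_
  have hpq := Prod.mk.inj (congrFun (congrFun (h a b) p) q)
  exact ⟨iff_of_eq hpq.1, fun k => iff_of_eq (congrFun hpq.2 k)⟩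

theorem SameType.pair {κ A F : Type*} {r : κ → A → A → Prop} {p : F → A} {x y x' y' : ν → A}
    (hx : SameType r r (Sum.elim p x) (Sum.elim p x'))
    (hy : SameType r r (Sum.elim p y) (Sum.elim p y')) (eq_iff : ∀ i j, x i = y j ↔ x' i = y' j)
    (rel_iff : ∀ k i j, r k (x i) (y j) ↔ r k (x' i) (y' j))
    (rel_swap_iff : ∀ k i j, r k (y i) (x j) ↔ r k (y' i) (x' j)) :
    SameType r r (Sum.elim p (Function.uncurry ![x, y]))
      (Sum.elim p (Function.uncurry ![x', y'])) := by
  rintro (d | ⟨a, i⟩) (e | ⟨b, j⟩)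
  · exact ⟨Iff.rfl, fun _ => Iff.rfl⟩
  · fin_cases b
    · exact hx (.inl d) (.inr j)
    · exact hy (.inl d) (.inr j)
  · fin_cases a
    · exact hx (.inr i) (.inl e)
    · exact hy (.inr i) (.inl e)
  · fin_cases a <;> fin_cases b
    · exact hx (.inr i) (.inr j)
    · exact ⟨eq_iff i j, fun k => rel_iff k i j⟩
    · exact ⟨eq_comm.trans ((eq_iff j i).trans eq_comm), fun k => rel_swap_iff k i j⟩
    · exact hy (.inr i) (.inr j)

/-- The type of a pair of tuples over `p` is determined by their adjacency matrix. -/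
def AdjacencyDetermined {I F : Type*} (p : F → M) (x : I → ν → M) : Prop :=
  ∀ a b a' b', a ≠ b → a' ≠ b' → adjMatrix (x a) (x b) = adjMatrix (x a') (x b') →
    SameType (binRel (L := Language.graph)) binRel
      (Sum.elim p (Function.uncurry ![x a, x b]))
      (Sum.elim p (Function.uncurry ![x a', x b']))

theorem unavoidable_adjacencyDetermined (hM : M ⊨ randomGraphTheory) {κ : Type} {F : Type*}
    [Finite F] [Finite ν] (p : F → M) :
    Unavoidable c κ (fun _ (x : _ → ν → M) => AdjacencyDetermined p x) := by
  refine ((unavoidable_sameType (binRel (L := Language.graph)) fun x : ν → M => Sum.elim p x).and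
    (.forall_of_finite (P := fun (q : ν × ν) _ (x : _ → ν → M) =>
        CrossUniform (fun a => x a q.1) fun a => x a q.2)
      (fun q => unavoidable_crossUniform (fun y : ν → M => y q.1) fun y : ν → M => y q.2)
      fun _ _ _ _ _ he h => h.comp he)
    fun _ _ _ h _ _ => h _ _).mono fun x ⟨same, cross⟩ a b a' b' hab hab' hadj => ?_
  have adj_iff {x y x' y' : ν → M} (h : adjMatrix x y = adjMatrix x' y')
      (R : Language.graph.Relations 2) (i j : ν) :
      binRel R (x i) (y j) ↔ binRel R (x' i) (y' j) := by
    obtain ⟨⟩ := R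
    exact iff_of_eq (congrFun (congrFun h i) j)
  refine (same a a').pair (same b b') (fun i j => cross (i, j) a b a' b' hab hab') (adj_iff hadj)
    (adj_iff ?_)
  rw [← adjMatrix_transpose hM, hadj, adjMatrix_transpose hM]

theorem exists_tuples_determining_relations (hM : M ⊨ randomGraphTheory)
    (hex : ExistsConfiguration (c.structures L) (trivialType Language.graph M n)) {A : Type}
    [Finite A] {r : L.Relations 2 → A → A → Prop} (hr : ∀ R, IsOfKind c (r R)) :
    ∃ x : A → Fin n → M, ∀ a b a' b', a ≠ b → a' ≠ b' →
      adjMatrix (x a) (x b) = adjMatrix (x a') (x b') → ∀ R, r R a b ↔ r R a' b' := by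
  classical
  obtain ⟨Γ, _, _, hlim, f, -, hf⟩ := hex
  choose φ hφ using hf 2
  choose F hF using fun R =>
    exists_finset_realize_iff (extendsTypes_randomGraph hM (isOfKind_adj hM)) (φ R)
  cases nonempty_fintype (L.Relations 2)
  let params : Finset M := Finset.univ.biUnion F
  obtain ⟨B, _, s, hs, exists_copy⟩ :=
    unavoidable_adjacencyDetermined hM ((↑) : params → M) (ν := Fin n) A r hr
  let _ : L.Structure B := structureOfRel s
  have hB : ⟨B, inferInstance⟩ ∈ c.structures L := ⟨inferInstance, hs⟩
  rw [← hlim.age] at hB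
  obtain ⟨-, ⟨h⟩⟩ := hB
  obtain ⟨e, he, determined⟩ := exists_copy fun b => f (h b)
  refine ⟨fun a => f (h (e a)), fun a b a' b' hab hab' hadj R => ?_⟩
  have rel_iff (a b : A) : r R a b ↔
      (φ R).Realize (Function.uncurry ![f (h (e a)), f (h (e b))]) := by
    rw [← he.map_rel_iff]
    refine (binRel_embedding h R (e a) (e b)).symm.trans ((hφ R _).trans (iff_of_eq ?_))
    congr! 1
    funext ⟨p, i⟩
    fin_cases p <;> rfl
  have subset_params : F R ⊆ params := Finset.subset_biUnion_of_mem F (Finset.mem_univ R)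
  rw [rel_iff, rel_iff]
  refine hF R _ _ ?_
  convert (determined a b a' b' hab hab' hadj).comp
    (Sum.map (fun p : F R => ⟨p, subset_params p.2⟩) id) using 1 <;>
  · ext (_ | _) <;> rfl

theorem exists_isMatrixCode_of_existsConfiguration (hM : M ⊨ randomGraphTheory)
    (hex : ExistsConfiguration (c.structures L) (trivialType Language.graph M n)) :
    ∃ g : (L.Relations 2 → Prop) → Matrix (Fin n) (Fin n) Prop, IsMatrixCode c g := by
  obtain ⟨A, _, r, hr, exists_pair⟩ := exists_finite_realizing_types c (L.Relations 2)
  obtain ⟨x, hx⟩ := exists_tuples_determining_relations hM hex hr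
  choose a b hne hab using exists_pair
  have type_eq (t : L.Relations 2 → Prop) : (fun R => r R (a t) (b t)) = t :=
    funext fun R => propext (hab t R)
  refine ⟨fun t => adjMatrix (x (a t)) (x (b t)), fun t t' => ⟨fun h => ?_, fun h => ?_⟩⟩
  · rw [← type_eq t, ← type_eq t']
    exact funext fun R => propext (hx _ _ _ _ (hne t) (hne t') h R)
  · rw [adjMatrix_transpose hM] at h
    rw [← type_eq t, ← type_eq t', IsOfKind.swapType_eq hr (hne t')]
    exact funext fun R => propext (hx _ _ _ _ (hne t) (hne t').symm h R)

theorem existsConfiguration_iff_exists_isMatrixCode [HasOnlyBinaryRelations L]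
    (hM : M ⊨ randomGraphTheory) (hn : 1 ≤ n) :
    ExistsConfiguration (c.structures L) (trivialType Language.graph M n) ↔
      ∃ g : (L.Relations 2 → Prop) → Matrix (Fin n) (Fin n) Prop, IsMatrixCode c g :=
  ⟨exists_isMatrixCode_of_existsConfiguration hM,
    fun ⟨_, hg⟩ => existsConfiguration_of_isMatrixCode hM ⟨0, hn⟩ hg⟩

end Configurations

/-! ### Counting matrix codes -/

section Counting

open scoped Matrix

variable {c : RelKind} {κ ν : Type*}

theorem IsMatrixCode.injective {g : (κ → Prop) → Matrix ν ν Prop} (hg : IsMatrixCode c g) :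
    Function.Injective g :=
  fun t t' => (hg t t').1

theorem card_fun_prop (κ : Type*) [Finite κ] : Nat.card (κ → Prop) = 2 ^ Nat.card κ := by
  rw [Nat.card_fun, Nat.card_congr Equiv.propEquivBool, Nat.card_eq_fintype_card, Fintype.card_bool]

theorem card_matrix_prop (ν : Type*) [Finite ν] :
    Nat.card (Matrix ν ν Prop) = 2 ^ Nat.card ν ^ 2 := by
  rw [Nat.card_congr (Matrix.of.symm.trans (Equiv.curry ν ν Prop).symm), card_fun_prop,
    Nat.card_prod, sq]

theorem IsMatrixCode.card_le [Finite κ] [Finite ν] {g : (κ → Prop) → Matrix ν ν Prop}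
    (hg : IsMatrixCode c g) : Nat.card κ ≤ Nat.card ν ^ 2 := by
  have := Nat.card_le_card_of_injective g hg.injective
  rwa [card_fun_prop, card_matrix_prop, Nat.pow_le_pow_iff_right one_lt_two] at this

theorem IsMatrixCode.surjective [Finite κ] [Finite ν] {g : (κ → Prop) → Matrix ν ν Prop}
    (hg : IsMatrixCode c g) (hcard : Nat.card κ = Nat.card ν ^ 2) : Function.Surjective g := by
  refine (hg.injective.bijective_of_nat_card_le ?_).2
  rw [card_fun_prop, card_matrix_prop, hcard]

/-- If there were `card ν ^ 2` relations, then every matrix would be a code. For linear orders and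
tournaments this is impossible for a symmetric matrix, and for graphs it is impossible for a
nonsymmetric matrix. -/
theorem IsMatrixCode.card_lt [Finite κ] [Nonempty κ] [Finite ν] {g : (κ → Prop) → Matrix ν ν Prop}
    (hg : IsMatrixCode c g) (hν : c = .graph → Nontrivial ν) : Nat.card κ < Nat.card ν ^ 2 := by
  refine hg.card_le.lt_of_ne fun hcard => ?_
  have hsurj := hg.surjective hcard
  by_cases hc : c = .graph
  · subst hc
    obtain ⟨i, j, hij⟩ := (hν rfl).exists_pair_ne
    obtain ⟨t, ht⟩ := hsurj (.of fun i' j' => i' = i ∧ j' = j)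
    obtain ⟨t', ht'⟩ := hsurj (g t)ᵀ
    have : t' = t := ((hg t' t).2 ht').trans (RelKind.swapType_graph t)
    rw [this, ht] at ht'
    simpa [hij] using congrFun (congrFun ht' i) j
  · obtain ⟨t, ht⟩ := hsurj fun _ _ => False
    exact RelKind.swapType_ne hc t ((hg t t).2 (by rw [ht]; rfl)).symm

/-- A code can be prescribed on one type of each pair of converse types. -/
theorem exists_isMatrixCode_of_half {S : Set (κ → Prop)} (hS : ∀ t, c.swapType t ∈ S ↔ t ∉ S)
    {b : (κ → Prop) → Matrix ν ν Prop} (hb : S.InjOn b)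
    (hbt : ∀ t ∈ S, ∀ u ∈ S, b t ≠ (b u)ᵀ) :
    ∃ g : (κ → Prop) → Matrix ν ν Prop, IsMatrixCode c g := by
  classical
  refine ⟨fun t => if t ∈ S then b t else (b (c.swapType t))ᵀ, fun t t' => ?_⟩
  have swap_inj {t t' : κ → Prop} (h : c.swapType t = c.swapType t') : t = t' := by
    rw [← c.swapType_swapType t, h, c.swapType_swapType]
  by_cases ht : t ∈ S <;> by_cases ht' : t' ∈ S <;> simp only [ht, ht', if_true, if_false]
  · exact ⟨fun h => hb ht ht' h, fun h => (hbt t ht t' ht' h).elim⟩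
  · exact ⟨fun h => (hbt t ht _ ((hS t').2 ht') h).elim,
      fun h => hb ht ((hS t').2 ht') h⟩
  · exact ⟨fun h => (hbt t' ht' _ ((hS t).2 ht) h.symm).elim,
      fun h => by rw [← hb ((hS t).2 ht) ht' (Matrix.transpose_injective h), c.swapType_swapType]⟩
  · exact ⟨fun h => swap_inj (hb ((hS t).2 ht) ((hS t').2 ht') (Matrix.transpose_injective h)),
      fun h => (hbt _ ((hS t).2 ht) _ ((hS t').2 ht') (Matrix.transpose_injective h)).elim⟩

/-- The types in which one relation `k₀` holds form a half of all types. They are coded by writing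
the relations into distinct entries, with `k₀` opposite to an entry that is always false. -/
theorem exists_isMatrixCode_of_embedding (hc : c ≠ .graph) (p : κ ↪ ν × ν) {k₀ : κ}
    (hp : ∀ k, p k ≠ (p k₀).swap) : ∃ g : (κ → Prop) → Matrix ν ν Prop, IsMatrixCode c g := by
  let b (t : κ → Prop) : Matrix ν ν Prop := .of fun i j => ∃ k, p k = (i, j) ∧ t k
  have b_entry (t : κ → Prop) (k : κ) : b t (p k).1 (p k).2 ↔ t k := by
    simp [b]
  have b_opposite (t : κ → Prop) : ¬ b t (p k₀).2 (p k₀).1 := fun ⟨k, hk, _⟩ => hp k hk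
  refine exists_isMatrixCode_of_half (S := {t | t k₀}) (b := b)
    (fun t => by simp [RelKind.swapType, hc]) (fun t _ u _ htu => funext fun k => propext ?_)
    fun t ht u _ h => b_opposite u ?_
  · rw [← b_entry t, htu, b_entry]
  · rw [← Matrix.transpose_apply (b u), ← h, b_entry]
    exact ht

theorem exists_embedding_ne_swap [Finite κ] [Nontrivial ν] [Finite ν] (k₀ : κ)
    (hcard : Nat.card κ < Nat.card ν ^ 2) : ∃ p : κ ↪ ν × ν, ∀ k, p k ≠ (p k₀).swap := by
  classical
  obtain ⟨i, j, hij⟩ := exists_pair_ne ν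
  cases nonempty_fintype κ
  cases nonempty_fintype ν
  have card_le : Fintype.card κ ≤ Fintype.card {q : ν × ν // q ≠ (j, i)} := by
    rw [Nat.card_eq_fintype_card, Nat.card_eq_fintype_card, sq, ← Fintype.card_prod] at hcard
    rw [Fintype.card_subtype_compl, Fintype.card_subtype_eq]
    lia
  obtain ⟨e⟩ := Function.Embedding.nonempty_of_card_le card_le
  let q₀ : {q : ν × ν // q ≠ (j, i)} := ⟨(i, j), by simp [hij]⟩
  refine ⟨(e.trans (Equiv.swap (e k₀) q₀).toEmbedding).trans (.subtype _), fun k => ?_⟩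
  simpa [q₀] using (Equiv.swap (e k₀) q₀ (e k)).2

theorem nontrivial_of_card_lt_sq [Finite κ] [Nonempty κ] [Finite ν]
    (hcard : Nat.card κ < Nat.card ν ^ 2) : Nontrivial ν := by
  rw [← Finite.one_lt_card_iff_nontrivial]
  have := Nat.card_pos (α := κ)
  nlinarith

theorem exists_transversal_of_involutive {X : Type*} [Finite X] {τ : X → X}
    (hτ : Function.Involutive τ) :
    ∃ S : Set X, Nat.card X ≤ 2 * S.ncard ∧ ∀ x ∈ S, ∀ y ∈ S, x = τ y → x = y := by
  classical
  let _ : LinearOrder X := linearOrderOfSTO WellOrderingRel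
  refine ⟨{x | x ≤ τ x}, ?_, ?_⟩
  · have cover : {x | x ≤ τ x} ∪ τ '' {x | x ≤ τ x} = Set.univ :=
      Set.eq_univ_of_forall fun x => (le_total x (τ x)).imp id
        fun h => ⟨τ x, by simpa [hτ x] using h, hτ x⟩
    rw [← Set.ncard_univ, ← cover, two_mul]
    refine (Set.ncard_union_le _ _).trans (Nat.add_le_add_left (Set.ncard_image_le) _)
  · rintro x hx y hy rfl
    exact le_antisymm (by simpa only [Set.mem_ofPred_eq, hτ y] using hx) hy

theorem exists_isMatrixCode_graph [Finite κ] [Finite ν] (hcard : Nat.card κ < Nat.card ν ^ 2) :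
    ∃ g : (κ → Prop) → Matrix ν ν Prop, IsMatrixCode .graph g := by
  obtain ⟨S, hScard, hS⟩ := exists_transversal_of_involutive
    (Matrix.transpose_transpose (m := ν) (n := ν) (α := Prop))
  have card_le : Nat.card (κ → Prop) ≤ Nat.card S := by
    have := Nat.pow_le_pow_right two_pos (Nat.succ_le_of_lt hcard)
    rw [card_matrix_prop] at hScard
    rw [card_fun_prop, Nat.card_coe_set_eq]
    rw [Nat.succ_eq_add_one, pow_succ] at this
    lia
  cases nonempty_fintype (κ → Prop)
  cases nonempty_fintype S
  rw [Nat.card_eq_fintype_card, Nat.card_eq_fintype_card] at card_le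
  obtain ⟨e⟩ := Function.Embedding.nonempty_of_card_le card_le
  refine ⟨fun t => e t, fun t t' => ⟨fun h => e.injective (Subtype.ext h), fun h => ?_⟩⟩
  rw [RelKind.swapType_graph]
  exact e.injective (Subtype.ext (hS _ (e t).2 _ (e t').2 h))

theorem exists_isMatrixCode_iff [Finite κ] [Nonempty κ] [Finite ν]
    (hν : c = .graph → Nontrivial ν) :
    (∃ g : (κ → Prop) → Matrix ν ν Prop, IsMatrixCode c g) ↔ Nat.card κ < Nat.card ν ^ 2 := by
  refine ⟨fun ⟨_, hg⟩ => hg.card_lt hν, fun hcard => ?_⟩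
  by_cases hc : c = .graph
  · exact hc ▸ exists_isMatrixCode_graph hcard
  · have := nontrivial_of_card_lt_sq hcard
    obtain ⟨p, hp⟩ := exists_embedding_ne_swap (Classical.arbitrary κ) hcard
    exact exists_isMatrixCode_of_embedding hc p hp

theorem exists_isMatrixCode_graph_iff_of_unique [Finite κ] [Unique ν] :
    (∃ g : (κ → Prop) → Matrix ν ν Prop, IsMatrixCode .graph g) ↔ Nat.card κ ≤ 1 := by
  refine ⟨fun ⟨_, hg⟩ => by simpa using hg.card_le, fun hcard => ?_⟩
  have : Subsingleton κ := Finite.card_le_one_iff_subsingleton.1 hcard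
  have code_inj {t t' : κ → Prop} (h : (∃ k, t k) = ∃ k, t' k) : t = t' := by
    ext k
    have : Unique κ := uniqueOfSubsingleton k
    simpa [Unique.exists_iff, Subsingleton.elim default k] using h
  refine ⟨fun t => .of fun _ _ => ∃ k, t k, fun t t' => ⟨fun h => ?_, fun h => ?_⟩⟩
  · exact code_inj (congrFun (congrFun h default) default)
  · rw [RelKind.swapType_graph]
    exact code_inj (congrFun (congrFun h default) default)

end Counting

section Rank

variable {M : Type*}

theorem hasRank_iff {L : FirstOrder.Language} [L.Structure M]
    {K : Set (Bundled.{0} binLang.Structure)} {β : Type} {π : Set (L[[M]].Formula β)} {N : ℕ}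
    (h : ∀ m, 1 ≤ m → (ExistsConfiguration (starPow K m) π ↔ m ≤ N)) (r : ℕ∞) :
    HasRank K π r ↔ r = N := by
  have exists_one : ExistsConfiguration K π ↔ 1 ≤ N := h 1 le_rfl
  constructor
  · rintro (⟨rfl, hnot⟩ | ⟨m, hm, rfl, hex, hnot⟩ | ⟨-, htop⟩)
    · rw [exists_one] at hnot
      exact_mod_cast (by lia : 0 = N)
    · rw [h m hm] at hex
      rw [h (m + 1) (by lia)] at hnot
      exact_mod_cast (by lia : m = N)
    · have := (h (N + 1) (by lia)).1 (htop (N + 1) (by lia))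
      lia
  · rintro rfl
    rcases Nat.eq_zero_or_pos N with rfl | hN
    · exact .inl ⟨Nat.cast_zero, by rw [exists_one]; lia⟩
    · exact .inr (.inl ⟨N, hN, rfl, (h N hN).2 le_rfl, by rw [h (N + 1) (by lia)]; lia⟩)

variable [Language.graph.Structure M] {c : RelKind} {m n : ℕ}

theorem existsConfiguration_starPow_iff (hM : M ⊨ randomGraphTheory) (hm : 1 ≤ m) (hn : 1 ≤ n)
    (hgraph : c = .graph → 1 < n) :
    ExistsConfiguration (starPow c.toClass m) (trivialType Language.graph M n) ↔
      m ≤ n ^ 2 - 1 := by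
  have card_eq := card_relations_starLang m
  have : Nonempty ((starLang binLang m).Relations 2) := (Nat.card_pos_iff.1 (by lia)).1
  rw [starPow_toClass, existsConfiguration_iff_exists_isMatrixCode hM hn,
    exists_isMatrixCode_iff fun hc => Fin.nontrivial_iff_two_le.2 (hgraph hc), card_eq,
    Nat.card_fin, Nat.lt_iff_le_pred (pow_pos hn 2)]

theorem existsConfiguration_starPow_graph_iff (hM : M ⊨ randomGraphTheory) :
    ExistsConfiguration (starPow RelKind.graph.toClass m) (trivialType Language.graph M 1) ↔
      m ≤ 1 := by
  rw [starPow_toClass, existsConfiguration_iff_exists_isMatrixCode hM le_rfl,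
    exists_isMatrixCode_graph_iff_of_unique, card_relations_starLang m]

theorem hasRank_toClass_iff (hM : M ⊨ randomGraphTheory) (hn : 1 ≤ n)
    (hgraph : c = .graph → 1 < n) (r : ℕ∞) :
    HasRank c.toClass (trivialType Language.graph M n) r ↔ r = ((n ^ 2 - 1 : ℕ) : ℕ∞) :=
  hasRank_iff (fun _ hm => existsConfiguration_starPow_iff hM hm hn hgraph) r

theorem hasRank_graph_iff (hM : M ⊨ randomGraphTheory) (r : ℕ∞) :
    HasRank RelKind.graph.toClass (trivialType Language.graph M 1) r ↔ r = 1 :=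
  hasRank_iff (fun _ _ => existsConfiguration_starPow_graph_iff hM) r

end Rank

end KRank

theorem mainTheorem3_general {M : Type*} [FirstOrder.Language.graph.Structure M]
    (hM : M ⊨ KRank.randomGraphTheory) (n : ℕ) (hn : 1 ≤ n) :
    (∀ r : ℕ∞, KRank.HasRank KRank.LO (KRank.trivialType FirstOrder.Language.graph M n) r ↔
      r = ((n ^ 2 - 1 : ℕ) : ℕ∞)) ∧
    (∀ r : ℕ∞, KRank.HasRank KRank.Tour (KRank.trivialType FirstOrder.Language.graph M n) r ↔
      r = ((n ^ 2 - 1 : ℕ) : ℕ∞)) ∧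
    (∀ r : ℕ∞, KRank.HasRank KRank.Gr (KRank.trivialType FirstOrder.Language.graph M n) r ↔
      r = if n = 1 then 1 else ((n ^ 2 - 1 : ℕ) : ℕ∞)) := by
  refine ⟨KRank.hasRank_toClass_iff (c := .linearOrder) hM hn nofun,
    KRank.hasRank_toClass_iff (c := .tournament) hM hn nofun, fun r => ?_⟩
  split_ifs with h
  · subst h
    exact KRank.hasRank_graph_iff hM r
  · exact KRank.hasRank_toClass_iff (c := .graph) hM hn (fun _ => by lia) r

/-- Let `M` be a monster model (any `ℵ₁`-saturated model) of the theory of the random graph. For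
each `n ≥ 1`, the type `y = y` in `n` variables has a unique linear order rank, tournament rank and
graph rank, and these ranks are as stated. -/
theorem mainTheorem3 {M : Type*} [FirstOrder.Language.graph.Structure M]
    (hM : M ⊨ KRank.randomGraphTheory)
    (hsat : KRank.IsAlephOneSaturated FirstOrder.Language.graph M)
    (n : ℕ) (hn : 1 ≤ n) :
    (∀ r : ℕ∞, KRank.HasRank KRank.LO (KRank.trivialType FirstOrder.Language.graph M n) r ↔
      r = ((n ^ 2 - 1 : ℕ) : ℕ∞)) ∧
    (∀ r : ℕ∞, KRank.HasRank KRank.Tour (KRank.trivialType FirstOrder.Language.graph M n) r ↔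
      r = ((n ^ 2 - 1 : ℕ) : ℕ∞)) ∧
    (∀ r : ℕ∞, KRank.HasRank KRank.Gr (KRank.trivialType FirstOrder.Language.graph M n) r ↔
      r = if n = 1 then 1 else ((n ^ 2 - 1 : ℕ) : ℕ∞)) :=
  mainTheorem3_general hM n hn
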